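/- **Setting.** Let $T\in(0,\infty]$ and let $\mathfrak m,\mathfrak a,\mathfrak b\in C^1([0,T))$ be real functions with $0<\mathfrak m(t)<\mathfrak a(t)<\mathfrak b(t)<2\mathfrak m(t)$ for all $0\le t<T$. Put $\mathfrak n=\frac{\mathfrak a^2-\mathfrak b^2}{4\mathfrak m}$ and $$\Gamma_A(t)=\{x\in\mathbb R^3:\ (x_1+\mathfrak m)^2+x_2^2+x_3^2=\mathfrak a^2,\ x_1<\mathfrak n\},$$ $$\Gamma_B(t)=\{x\in\mathbb R^3:\ (x_1-\mathfrak m)^2+x_2^2+x_3^2=\mathfrak b^2,\ x_1>\mathfrak n\},$$ $$\Gamma_S(t)=\{x\in\mathbb R^3:\ (x_1+\mathfrak m)^2+x_2^2+x_3^2\le\mathfrak a^2,\ x_1=\mathfrak n\}.$$ Let $y_A=(\mathfrak m+\mathfrak n+\tfrac{\mathfrak a}{2})r-\tfrac{\mathfrak a}{2}$, $\ y_B=(\mathfrak m-\mathfrak n+\tfrac{\mathfrak b}{2})r-\tfrac{\mathfrak b}{2}$, and $$\widehat x_{A1}(r,\vartheta,t)=\begin{pmatrix}-\sqrt{\mathfrak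 a^2-\frac{3\mathfrak a^2r^2}{4}}-\mathfrak m\\ \frac{\sqrt3}{2}\mathfrak a r\cos\vartheta\\ \frac{\sqrt3}{2}\mathfrak a r\sin\vartheta\end{pmatrix},\qquad \widehat x_{A2}(r,\vartheta,t)=\begin{pmatrix}y_A-\mathfrak m\\ \sqrt{\mathfrak a^2-y_A^2}\cos\vartheta\\ \sqrt{\mathfrak a^2-y_A^2}\sin\vartheta\end{pmatrix},$$ $$\widehat x_{B1}(r,\vartheta,t)=\begin{pmatrix}\mathfrak m-y_B\\ \sqrt{\mathfrak b^2-y_B^2}\cos\vartheta\\ \sqrt{\mathfrak b^2-y_B^2}\sin\vartheta\end{pmatrix},\qquad \widehat x_{B2}(r,\vartheta,t)=\begin{pmatrix}\sqrt{\mathfrak b^2-\frac{3\mathfrak b^2r^2}{4}}+\mathfrak m\\ \frac{\sqrt3}{2}\mathfrak b r\cos\vartheta\\ \frac{\sqrt3}{2}\mathfrak b r\sin\vartheta\end{pmatrix},$$ $$\widehat x_{S}(r,\vartheta,t)=\begin{pmatrix}\mathfrak n\\ \sqrt{\mathfrak a^2-(\mathfrak m+\mathfrak n)^2}\,r\cos\vartheta\\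 \sqrt{\mathfrak a^2-(\mathfrak m+\mathfrak n)^2}\,r\sin\vartheta\end{pmatrix}.$$ Let $D=[0,1)\times[0,2\pi]$ and $\overline D=[0,1]\times[0,2\pi]$. For $0<t<T$ the *motion velocity* is given by $$w_A(\widehat x_{A1}(r,\vartheta,t),t)=\tfrac{\partial\widehat x_{A1}}{\partial t}(r,\vartheta,t)\ \text{ on } D,\qquad w_A(\widehat x_{A2}(r,\vartheta,t),t)=\tfrac{\partial\widehat x_{A2}}{\partial t}(r,\vartheta,t)\ \text{ on } \overline D,$$ $$w_B(\widehat x_{B1}(r,\vartheta,t),t)=\tfrac{\partial\widehat x_{B1}}{\partial t}(r,\vartheta,t)\ \text{ on } \overline D,\qquad w_B(\widehat x_{B2}(r,\vartheta,t),t)=\tfrac{\partial\widehat x_{B2}}{\partial t}(r,\vartheta,t)\ \text{ on } D,$$ $$w_S(\widehat x_S(r,\vartheta,t),t)=\tfrac{\partial\widehat x_S}{\partial t}(r,\vartheta,t)\ \text{ on } \overline D .$$ With a unit normal $n_\sharp$ of $\Gamma_\sharp(t)$ put $\mathrm{div}_{\Gamma_\sharp}\varphi=\sum_{i,j=1}^3(\delta_{ij}-n^\sharp_in^\sharp_j)\,\partial_i\varphi_j$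 (at points where $\varphi$ is differentiable along $\Gamma_\sharp(t)$; only derivatives in tangential directions enter), and $D_t^{w}f=\partial_tf+(w\cdot\nabla)f$. A family $\Omega(t)\subset\Gamma_\sharp(t)$, $0<t<T$, is called a *moving portion* of $\Gamma_\sharp$ if there are Lebesgue measurable sets of parameters, independent of $t$, namely $U_1\subset D$, $U_2\subset\overline D$ if $\sharp=A$; $U_1\subset\overline D$, $U_2\subset D$ if $\sharp=B$; $U\subset\overline D$ if $\sharp=S$, such that $\Omega(t)=\widehat x_{\sharp1}(U_1,t)\cup\widehat x_{\sharp2}(U_2,t)$ if $\sharp=A,B$, and $\Omega(t)=\widehat x_S(U,t)$ if $\sharp=S$, for all $0<t<T$. **Proposition 5.2 (Transport theorem on double bubble).** Let $\sharp\in\{A,B,S\}$. The formulas above define $w_\sharp$ unambiguously, and for every $0<t<T$ the field $w_\sharp(\cdot,t)$ is differentiable along $\Gamma_\sharp(t)$ at $\mathcal H^2$-almost every point of $\Gamma_\sharp(t)$. Moreover, for every $f\in C^1(\mathbb R^4)$, every moving portion $\Omega(t)\subset\Gamma_\sharp(t)$ and every $0<t<T$, both integrands below are $\mathcal H^2$-integrable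 over $\Omega(t)$, the derivative on the left exists, and $$\frac{d}{dt}\int_{\Omega(t)}f(x,t)\,d\mathcal H^2_x=\int_{\Omega(t)}\big\{D_t^{w_\sharp}f+(\mathrm{div}_{\Gamma_\sharp}w_\sharp)f\big\}(x,t)\,d\mathcal H^2_x .$$ -/

import Mathlib

open scoped MeasureTheory

noncomputable section

namespace DoubleBubble

/-- Euclidean three-space. -/
abbrev E3 : Type := EuclideanSpace ℝ (Fin 3)

/-- The labels of the three pieces of the double bubble. -/
inductive Piece : Type
  | A
  | B
  | S

/-- The time interval `[0, T)`, where `T` may be `∞`. -/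
def timeInterval (T : EReal) : Set ℝ := {t : ℝ | 0 ≤ t ∧ (t : EReal) < T}

/-- The open time interval `(0, T)`, where `T` may be `∞`. -/
def openTimeInterval (T : EReal) : Set ℝ := {t : ℝ | 0 < t ∧ (t : EReal) < T}

/-! ### The evolving double bubble

`m`, `a`, `b` are the functions of time that determine the bubble: the two spheres have the
centers `(-m, 0, 0)` and `(m, 0, 0)` and the radii `a` and `b`. -/

/-- The first coordinate `𝔫 = (𝔞² - 𝔟²) / (4 𝔪)` of the plane that contains the separating disc. -/
def planeCoord (m a b : ℝ → ℝ) (t : ℝ) : ℝ := (a t ^ 2 - b t ^ 2) / (4 * m t)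

/-- The three pieces `Γ_A(t)`, `Γ_B(t)`, `Γ_S(t)` (coordinates are numbered from `0`). -/
def Gam (m a b : ℝ → ℝ) : Piece → ℝ → Set E3
  | Piece.A, t => {x | (x 0 + m t) ^ 2 + x 1 ^ 2 + x 2 ^ 2 = a t ^ 2 ∧ x 0 < planeCoord m a b t}
  | Piece.B, t => {x | (x 0 - m t) ^ 2 + x 1 ^ 2 + x 2 ^ 2 = b t ^ 2 ∧ planeCoord m a b t < x 0}
  | Piece.S, t => {x | (x 0 + m t) ^ 2 + x 1 ^ 2 + x 2 ^ 2 ≤ a t ^ 2 ∧ x 0 = planeCoord m a b t}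

/-- A unit normal field on each piece: the outer normal of the sphere on `Γ_A` and `Γ_B`, and the
first unit vector on the flat disc `Γ_S`. (The surface derivatives below do not depend on its
orientation.) -/
def normal (m a b : ℝ → ℝ) : Piece → ℝ → E3 → E3
  | Piece.A, t, x => (a t)⁻¹ • (x - !₂[-m t, 0, 0])
  | Piece.B, t, x => (b t)⁻¹ • (x - !₂[m t, 0, 0])
  | Piece.S, _, _ => !₂[1, 0, 0]

/-! ### The explicit parametrizations; the parameter is `p = (r, ϑ)` -/

/-- The cap of `Γ_A` around its pole. -/
def xA1 (m a : ℝ → ℝ) (p : ℝ × ℝ) (t : ℝ) : E3 :=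
  !₂[-√(a t ^ 2 - 3 * a t ^ 2 * p.1 ^ 2 / 4) - m t,
    √3 / 2 * a t * p.1 * Real.cos p.2,
    √3 / 2 * a t * p.1 * Real.sin p.2]

/-- Height of the point `xA2` above the center of its sphere. -/
def yA2 (m a b : ℝ → ℝ) (r t : ℝ) : ℝ :=
  m t * r + planeCoord m a b t * r + a t * r / 2 - a t / 2

/-- The zone of `Γ_A` between the cap and the disc. -/
def xA2 (m a b : ℝ → ℝ) (p : ℝ × ℝ) (t : ℝ) : E3 :=
  !₂[yA2 m a b p.1 t - m t,
    √(a t ^ 2 - yA2 m a b p.1 t ^ 2) * Real.cos p.2,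
    √(a t ^ 2 - yA2 m a b p.1 t ^ 2) * Real.sin p.2]

/-- Depth of the point `xB1` below the center of its sphere. -/
def yB1 (m a b : ℝ → ℝ) (r t : ℝ) : ℝ :=
  m t * r - planeCoord m a b t * r + b t * r / 2 - b t / 2

/-- The zone of `Γ_B` between the disc (`r = 1`) and the cap (`r = 0`). -/
def xB1 (m a b : ℝ → ℝ) (p : ℝ × ℝ) (t : ℝ) : E3 :=
  !₂[m t - yB1 m a b p.1 t,
    √(b t ^ 2 - yB1 m a b p.1 t ^ 2) * Real.cos p.2,
    √(b t ^ 2 - yB1 m a b p.1 t ^ 2) * Real.sin p.2]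

/-- The cap of `Γ_B` around its pole. -/
def xB2 (m b : ℝ → ℝ) (p : ℝ × ℝ) (t : ℝ) : E3 :=
  !₂[√(b t ^ 2 - 3 * b t ^ 2 * p.1 ^ 2 / 4) + m t,
    √3 / 2 * b t * p.1 * Real.cos p.2,
    √3 / 2 * b t * p.1 * Real.sin p.2]

/-- The separating disc `Γ_S`. -/
def xS (m a b : ℝ → ℝ) (p : ℝ × ℝ) (t : ℝ) : E3 :=
  !₂[planeCoord m a b t,
    √(a t ^ 2 - (m t + planeCoord m a b t) ^ 2) * p.1 * Real.cos p.2,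
    √(a t ^ 2 - (m t + planeCoord m a b t) ^ 2) * p.1 * Real.sin p.2]

/-- `{(r, ϑ) : 0 ≤ r < 1, 0 ≤ ϑ ≤ 2π}`, the parameter domain `U_{A1} = U_{B2}` of the caps. -/
def capDomain : Set (ℝ × ℝ) := Set.Ico (0 : ℝ) 1 ×ˢ Set.Icc (0 : ℝ) (2 * Real.pi)

/-- `{(r, ϑ) : 0 ≤ r ≤ 1, 0 ≤ ϑ ≤ 2π}`, the closure of the parameter domains `U_{A2} = U_{B1}` and
`U_S`. -/
def closedDomain : Set (ℝ × ℝ) := Set.Icc (0 : ℝ) 1 ×ˢ Set.Icc (0 : ℝ) (2 * Real.pi)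

/-! ### The motion velocity -/

open Classical in
/-- The velocity at the point `x` at time `t` of a surface that is parametrized by `φ` on the
parameter set `U` and, outside `φ(U, t)`, by `ψ` on `V`: it is `∂φ/∂t (p, t)` if `x = φ(p, t)` with
`p ∈ U`, and `∂ψ/∂t (q, t)` if `x = ψ(q, t)` with `q ∈ V`. -/
def twoChartVelocity (φ : ℝ × ℝ → ℝ → E3) (U : Set (ℝ × ℝ)) (ψ : ℝ × ℝ → ℝ → E3)
    (V : Set (ℝ × ℝ)) (x : E3) (t : ℝ) : E3 :=
  if h : ∃ p ∈ U, x = φ p t then deriv (fun s => φ h.choose s) t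
  else if h' : ∃ q ∈ V, x = ψ q t then deriv (fun s => ψ h'.choose s) t
  else 0

/-- The motion velocities `w_A`, `w_B`, `w_S`. -/
def velocity (m a b : ℝ → ℝ) : Piece → E3 → ℝ → E3
  | Piece.A => twoChartVelocity (xA1 m a) capDomain (xA2 m a b) closedDomain
  | Piece.B => twoChartVelocity (xB2 m b) capDomain (xB1 m a b) closedDomain
  | Piece.S => twoChartVelocity (xS m a b) closedDomain (xS m a b) closedDomain

/-- `w` satisfies `w(x̂(r, ϑ, t), t) = ∂x̂/∂t (r, ϑ, t)` for every parametrization `x̂` of the piece,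
every admissible parameter `(r, ϑ)` and all `0 < t < T`. -/
def IsMotionVelocity (T : EReal) (m a b : ℝ → ℝ) : Piece → (E3 → ℝ → E3) → Prop
  | Piece.A, w => ∀ t ∈ openTimeInterval T,
      (∀ p ∈ capDomain, w (xA1 m a p t) t = deriv (fun s => xA1 m a p s) t) ∧
      (∀ p ∈ closedDomain, w (xA2 m a b p t) t = deriv (fun s => xA2 m a b p s) t)
  | Piece.B, w => ∀ t ∈ openTimeInterval T,
      (∀ p ∈ closedDomain, w (xB1 m a b p t) t = deriv (fun s => xB1 m a b p s) t) ∧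
      (∀ p ∈ capDomain, w (xB2 m b p t) t = deriv (fun s => xB2 m b p s) t)
  | Piece.S, w => ∀ t ∈ openTimeInterval T,
      ∀ p ∈ closedDomain, w (xS m a b p t) t = deriv (fun s => xS m a b p s) t

/-! ### Portions of the surface that move with it -/

/-- `Ω(t) ⊂ Γ_♯(t)`, `0 < t < T`, is a (Lebesgue measurable) portion of the surface that moves with
it: it is the image under the parametrizations of Lebesgue measurable sets of parameters that do
not depend on `t`. -/
def IsMovingPortion (T : EReal) (m a b : ℝ → ℝ) (p : Piece) (Ω : ℝ → Set E3) : Prop :=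
  (∀ t ∈ openTimeInterval T, Ω t ⊆ Gam m a b p t) ∧
  match p with
  | Piece.A => ∃ U V : Set (ℝ × ℝ),
      MeasureTheory.NullMeasurableSet U ∧ MeasureTheory.NullMeasurableSet V ∧
      U ⊆ capDomain ∧ V ⊆ closedDomain ∧
      ∀ t ∈ openTimeInterval T,
        Ω t = (fun q => xA1 m a q t) '' U ∪ (fun q => xA2 m a b q t) '' V
  | Piece.B => ∃ U V : Set (ℝ × ℝ),
      MeasureTheory.NullMeasurableSet U ∧ MeasureTheory.NullMeasurableSet V ∧
      U ⊆ closedDomain ∧ V ⊆ capDomain ∧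
      ∀ t ∈ openTimeInterval T,
        Ω t = (fun q => xB1 m a b q t) '' U ∪ (fun q => xB2 m b q t) '' V
  | Piece.S => ∃ U : Set (ℝ × ℝ),
      MeasureTheory.NullMeasurableSet U ∧ U ⊆ closedDomain ∧
      ∀ t ∈ openTimeInterval T, Ω t = (fun q => xS m a b q t) '' U

/-! ### Differential operators -/

/-- `∂_j^Γ g = ∑_i (δ_ij - n_i n_j) ∂_i g` at `x ∈ Γ`, for a function `g` on the surface `Γ` with
unit normal `n`. The derivative is taken within `Γ`: derivatives within `Γ` agree on the tangent
plane of `Γ` (with each other, and with the derivative of every differentiable extension of `g`),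
and the projection `δ_ij - n_i n_j` only sees the tangent plane. -/
def surfDeriv (Γ : Set E3) (n : E3 → E3) (g : E3 → ℝ) (j : Fin 3) (x : E3) : ℝ :=
  ∑ i : Fin 3, ((if i = j then 1 else 0) - n x i * n x j) *
    fderivWithin ℝ g Γ x (EuclideanSpace.single i 1)

/-- The surface divergence `div_Γ φ = ∑_j ∂_j^Γ φ_j`. -/
def surfDiv (Γ : Set E3) (n : E3 → E3) (φ : E3 → E3) (x : E3) : ℝ :=
  ∑ j : Fin 3, surfDeriv Γ n (fun y => φ y j) j x

/-- The material derivative `D_t^w f = ∂_t f + (w · ∇) f`. -/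
def materialDeriv (w : E3 → ℝ → E3) (f : E3 → ℝ → ℝ) (x : E3) (t : ℝ) : ℝ :=
  deriv (fun s => f x s) t +
    ∑ i : Fin 3, w x t i * fderiv ℝ (fun y => f y t) x (EuclideanSpace.single i 1)

/-- The integrand `D_t^{w_♯} f + (div_{Γ_♯} w_♯) f` of the transport theorem. -/
def transportIntegrand (m a b : ℝ → ℝ) (p : Piece) (f : E3 → ℝ → ℝ) (x : E3) (t : ℝ) : ℝ :=
  materialDeriv (velocity m a b p) f x t +
    surfDiv (Gam m a b p t) (normal m a b p t) (fun y => velocity m a b p y t) x * f x t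

end DoubleBubble

end

/-! The surface is pulled back to the fixed parameter set, where the domain of integration no longer
moves. By the area formula, an integral over a portion becomes an integral of `f(φ(q, s), s)`
against the area density of the chart `φ(·, s)`. All five charts are surfaces of revolution whose
partial derivatives are orthogonal, so this density is the product of the norms of the two partials,
and in each case it splits as `j(s) u(q)`. Differentiating under the integral sign, `j f` has the
derivative `j (D_t f + (j'/j) f)`. The transport theorem is thus reduced to the pointwise identity
that the surface divergence of the velocity equals `j'/j`.

The three densities explain themselves. A cap moves by a homothety about its moving center, so `j =
R²`. A zone is parametrized linearly by height, and by Archimedes' theorem spherical area is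
proportional to height, so `j = R k`, where `k` is the height of the zone. The disc is scaled by its
radius, so `j = ρ²`.

To compute the divergence, the velocity is extended to an axially symmetric field on space
(`capField`, `zoneField`, `discField`), which also shows that the velocity depends only on the point
and not on its parameter. For such a field the divergence is an explicit expression in the axial and
radial coefficients (`surfDiv_revolve`). The derivative within a surface is not unique, but it is
unique on the tangent cone, and the tangential projection sees nothing else
(`surfDiv_eq_of_eventuallyEq`).

The two spherical pieces are mirror images in form and share one treatment with a sign `σ = ±1`
(`IsSphericalData`). Each is the disjoint union of a cap and a zone, separated by the plane at depth
`-R/2` from the center. Edges of the parameter rectangle (pole, seam, rim, meridian) have null image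
because charts are Lipschitz, so all identities are needed only at interior parameters.

The measure-theoretic input is the area formula for the Hausdorff measure
(`euclideanHausdorffMeasure_image_eq_lintegral`): near each point the map is a bi-Lipschitz
perturbation of its derivative with constants close to `1`, and Besicovitch differentiation turns
this into the density. -/

open scoped MeasureTheory ENNReal NNReal Topology
open MeasureTheory Set Filter Metric

namespace MeasureTheory

/-! ### Hausdorff measures of images under comparable maps -/

section HausdorffComparison

variable {α X Y : Type*} [MetricSpace X] [MeasurableSpace X] [BorelSpace X]
  [MetricSpace Y] [MeasurableSpace Y] [BorelSpace Y]

theorem _root_.LipschitzOnWith.euclideanHausdorffMeasure_image_le {K : ℝ≥0} {f : X → Y} {s : Set X}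
    (h : LipschitzOnWith K f s) (d : ℕ) :
    μHE[d] (f '' s) ≤ (K : ℝ≥0∞) ^ d * μHE[d] s := by
  simp_rw [Measure.euclideanHausdorffMeasure_def, Measure.smul_apply]
  have := h.hausdorffMeasure_image_le (d := d) (by positivity)
  rw [ENNReal.rpow_natCast] at this
  simp only [ENNReal.smul_def, smul_eq_mul]
  grw [this]
  exact (mul_left_comm _ _ _).le

/-- If the distances of the values of `g` are at most `K` times those of `f`, then the Hausdorff
measures of the images compare accordingly. -/
theorem euclideanHausdorffMeasure_image_le_of_dist_le {K : ℝ≥0} {f : α → X} {g : α → Y} {s : Set α}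
    (h : ∀ x ∈ s, ∀ y ∈ s, dist (g x) (g y) ≤ K * dist (f x) (f y)) (d : ℕ) :
    μHE[d] (g '' s) ≤ (K : ℝ≥0∞) ^ d * μHE[d] (f '' s) := by
  rcases s.eq_empty_or_nonempty with rfl | ⟨x₀, hx₀⟩
  · simp
  have : Nonempty α := ⟨x₀⟩
  -- The distance bound forces `g` to be constant on the fibres of `f`, so on `s` it factors through
  -- `f`; the factor `g ∘ σ` is `K`-Lipschitz on `f '' s`.
  set σ := Function.invFunOn f s
  have hσ : ∀ x ∈ s, σ (f x) ∈ s ∧ f (σ (f x)) = f x := fun x hx =>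
    ⟨Function.invFunOn_mem ⟨x, hx, rfl⟩, Function.invFunOn_eq ⟨x, hx, rfl⟩⟩
  have hg : ∀ x ∈ s, g (σ (f x)) = g x := fun x hx => by
    have := h _ (hσ x hx).1 x hx
    rw [(hσ x hx).2, dist_self, mul_zero] at this
    exact dist_le_zero.1 this
  have him : g '' s = (g ∘ σ) '' (f '' s) := by
    rw [image_image]
    exact image_congr fun x hx => (hg x hx).symm
  rw [him]
  refine LipschitzOnWith.euclideanHausdorffMeasure_image_le ?_ d
  refine LipschitzOnWith.of_dist_le_mul ?_
  rintro _ ⟨x, hx, rfl⟩ _ ⟨y, hy, rfl⟩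
  simpa [hg x hx, hg y hy] using h x hx y hy

end HausdorffComparison

/-! ### Area formula for injective maps -/

section AreaFormula

set_option linter.unusedSectionVars false

variable {E F : Type*} [NormedAddCommGroup E] [NormedSpace ℝ E] [FiniteDimensional ℝ E]
  [MeasurableSpace E] [BorelSpace E] [NormedAddCommGroup F] [NormedSpace ℝ F]
  [MeasurableSpace F] [BorelSpace F]
  {μ : Measure E} {d : ℕ}

/-- Near a point of strict differentiability with an injective derivative `L`, the measures of
images under `f` and under `L` have ratios close to `1`. -/
theorem eventually_euclideanHausdorffMeasure_image_comparison {f : E → F} {L : E →L[ℝ] F} {x : E}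
    (hf : HasStrictFDerivAt f L x) {c : ℝ≥0} (hL : AntilipschitzWith c L) {K : ℝ≥0} (hK : 1 < K)
    (d : ℕ) :
    ∃ U ∈ 𝓝 x, ∀ s ⊆ U,
      μHE[d] (f '' s) ≤ (K : ℝ≥0∞) ^ d * μHE[d] (L '' s) ∧
      μHE[d] (L '' s) ≤ (K : ℝ≥0∞) ^ d * μHE[d] (f '' s) := by
  have hK' : (1 : ℝ) < K := by exact_mod_cast hK
  -- This relative error serves both directions: `1 - δ = 1 / K` exactly, and `1 + δ ≤ K` because `K
  -- + 1 / K ≥ 2`. The `+ 1` in `ε` below covers the case `c = 0`.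
  set δ : ℝ := 1 - 1 / K with hδ
  have hδ0 : 0 < δ := by rw [hδ, sub_pos, div_lt_one (by linarith)]; exact hK'
  have hc0 : (0 : ℝ) ≤ c := c.2
  set ε : ℝ≥0 := ⟨δ / (c + 1), by positivity⟩ with hε
  have hεc : (ε : ℝ) * c ≤ δ := by
    change δ / (c + 1) * c ≤ δ
    rw [div_mul_eq_mul_div, div_le_iff₀ (by positivity)]
    nlinarith
  have hε0 : 0 < ε := by
    rw [← NNReal.coe_pos]; change 0 < δ / (c + 1); positivity
  obtain ⟨U, hU, hfU⟩ := hf.approximates_deriv_on_nhds (c := ε) (Or.inr hε0)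
  have hmain : ∀ y ∈ U, ∀ z ∈ U, ‖f y - f z - L (y - z)‖ ≤ δ * ‖L y - L z‖ := by
    intro y hy z hz
    have h1 := hfU y hy z hz
    have h2 := hL.le_mul_dist y z
    rw [dist_eq_norm, dist_eq_norm] at h2
    calc ‖f y - f z - L (y - z)‖ ≤ ε * ‖y - z‖ := h1
      _ ≤ ε * (c * ‖L y - L z‖) := by gcongr
      _ = (ε * c) * ‖L y - L z‖ := by ring
      _ ≤ δ * ‖L y - L z‖ := by gcongr
  have hKinv : (1 : ℝ) / K * K = 1 := by field_simp
  refine ⟨U, hU, fun s hs => ⟨?_, ?_⟩⟩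
  · refine euclideanHausdorffMeasure_image_le_of_dist_le (fun y hy z hz => ?_) d
    have h := hmain y (hs hy) z (hs hz)
    rw [dist_eq_norm, dist_eq_norm]
    have h3 : ‖f y - f z‖ ≤ ‖f y - f z - L (y - z)‖ + ‖L y - L z‖ := by
      rw [← map_sub]
      simpa using norm_add_le (f y - f z - L (y - z)) (L (y - z))
    have h4 : (1 : ℝ) + δ ≤ K := by
      have : (1 : ℝ) / K * K = 1 := hKinv
      have h0 : (0 : ℝ) < 1 / K := by positivity
      nlinarith [sq_nonneg ((K : ℝ) - 1)]
    nlinarith [norm_nonneg (L y - L z)]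
  · refine euclideanHausdorffMeasure_image_le_of_dist_le (fun y hy z hz => ?_) d
    have h := hmain y (hs hy) z (hs hz)
    rw [dist_eq_norm, dist_eq_norm]
    have h3 : ‖L y - L z‖ ≤ ‖f y - f z - L (y - z)‖ + ‖f y - f z‖ := by
      rw [← map_sub, norm_sub_rev (f y - f z)]
      simpa using norm_add_le (L (y - z) - (f y - f z)) (f y - f z)
    have h5 : 1 / (K : ℝ) * ‖L y - L z‖ ≤ ‖f y - f z‖ := by
      have : 1 / (K : ℝ) = 1 - δ := by rw [hδ]; ring
      rw [this]; linarith
    calc ‖L y - L z‖ = K * (1 / (K : ℝ) * ‖L y - L z‖) := by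
          rw [← mul_assoc, mul_comm (K : ℝ), hKinv, one_mul]
      _ ≤ K * ‖f y - f z‖ := by gcongr

variable [μ.IsAddHaarMeasure]

/-- On `E` itself the Hausdorff measure of full dimension is a Haar measure, so it vanishes on
`μ`-null sets, and Lipschitz maps preserve this. -/
theorem euclideanHausdorffMeasure_image_eq_zero [hd : Fact (Module.finrank ℝ E = d)] {f : E → F}
    {s : Set E} {C : ℝ≥0} (hf : LipschitzOnWith C f s) (hs : μ s = 0) : μHE[d] (f '' s) = 0 := by
  have hd := hd.out
  subst hd
  have h0 : μHE[Module.finrank ℝ E] s = 0 :=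
    Measure.absolutelyContinuous_isAddHaarMeasure μHE[Module.finrank ℝ E] μ hs
  refine le_antisymm ?_ bot_le
  simpa [h0] using hf.euclideanHausdorffMeasure_image_le (Module.finrank ℝ E)

theorem euclideanHausdorffMeasure_image_lt_top [hd : Fact (Module.finrank ℝ E = d)] {f : E → F}
    {s : Set E} {C : ℝ≥0} (hf : LipschitzOnWith C f s) (hs : Bornology.IsBounded s) :
    μHE[d] (f '' s) < ∞ := by
  have hd := hd.out
  subst hd
  refine (hf.euclideanHausdorffMeasure_image_le (Module.finrank ℝ E)).trans_lt ?_
  exact ENNReal.mul_lt_top (by simp) hs.measure_lt_top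

/-- **Area formula** for injective `C¹` maps, for measurable subsets of an open set. -/
theorem euclideanHausdorffMeasure_image_eq_lintegral [hd : Fact (Module.finrank ℝ E = d)]
    {f : E → F} {f' : E → E →L[ℝ] F}
    {U : Set E} {C : ℝ≥0} (hU : IsOpen U) (hUb : Bornology.IsBounded U)
    (hlip : LipschitzOnWith C f U) (hinj : InjOn f U)
    (hf : ∀ x ∈ U, HasStrictFDerivAt f (f' x) x)
    (hf' : ∀ x ∈ U, ∃ c, AntilipschitzWith c (f' x)) {J : E → ℝ≥0}
    (hJ : ∀ x ∈ U, ∀ s, μHE[d] (f' x '' s) = J x * μ s)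
    {s : Set E} (hs : MeasurableSet s) (hsU : s ⊆ U) :
    μHE[d] (f '' s) = ∫⁻ x in s, J x ∂μ := by
  have hemb : MeasurableEmbedding (U.domRestrict f) :=
    hlip.continuousOn.measurableEmbedding hU.measurableSet hinj
  -- The pulled-back measure `A ↦ μHE[d] (f '' (A ∩ U))`; it is additive because `f` is injective on
  -- `U`. The area formula says that its density is `J`.
  set ν : Measure E := (Measure.comap (U.domRestrict f) μHE[d]).map (Subtype.val : U → E) with hν
  have hνs : ∀ t, MeasurableSet t → ν t = μHE[d] (f '' (t ∩ U)) := by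
    intro t ht
    rw [hν, Measure.map_apply measurable_subtype_coe ht, hemb.comap_apply]
    congr 1
    ext y
    constructor
    · rintro ⟨x, hx, rfl⟩; exact ⟨x, ⟨hx, x.2⟩, rfl⟩
    · rintro ⟨x, ⟨hx, hxU⟩, rfl⟩; exact ⟨⟨x, hxU⟩, hx, rfl⟩
  have : IsFiniteMeasure ν := ⟨by
    rw [hνs _ MeasurableSet.univ, univ_inter]
    exact euclideanHausdorffMeasure_image_lt_top hlip hUb⟩
  have hac : ν ≪ μ := by
    refine Measure.AbsolutelyContinuous.mk fun t ht h0 => ?_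
    rw [hνs t ht]
    exact euclideanHausdorffMeasure_image_eq_zero (μ := μ) (hlip.mono inter_subset_right)
      (measure_mono_null inter_subset_left h0)
  -- Almost everywhere the density is the limit of ratios on small balls. Comparison with the
  -- derivative places these ratios between `K⁻ᵈ J x` and `Kᵈ J x` for every `K > 1`, and then `K →
  -- 1`.
  have hrn : ∀ᵐ x ∂μ, x ∈ U → ν.rnDeriv μ x = J x := by
    filter_upwards [Besicovitch.ae_tendsto_rnDeriv ν μ] with x hx hxU
    have hle : ∀ K : ℝ≥0, 1 < K →
        ν.rnDeriv μ x ≤ (K : ℝ≥0∞) ^ d * J x ∧ (J x : ℝ≥0∞) ≤ (K : ℝ≥0∞) ^ d * ν.rnDeriv μ x := by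
      intro K hK
      obtain ⟨c, hc⟩ := hf' x hxU
      obtain ⟨V, hV, hVs⟩ :=
        eventually_euclideanHausdorffMeasure_image_comparison (hf x hxU) hc hK d
      obtain ⟨ε, hε, hεV⟩ := Metric.nhds_basis_closedBall.mem_iff.1
        (inter_mem hV (hU.mem_nhds hxU))
      have hev : ∀ᶠ r in 𝓝[>] (0 : ℝ),
          ν (closedBall x r) / μ (closedBall x r) ≤ (K : ℝ≥0∞) ^ d * J x ∧
          (J x : ℝ≥0∞) ≤ (K : ℝ≥0∞) ^ d * (ν (closedBall x r) / μ (closedBall x r)) := by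
        filter_upwards [Ioc_mem_nhdsGT hε] with r hr
        have hsub : closedBall x r ⊆ V ∩ U := (closedBall_subset_closedBall hr.2).trans hεV
        have hpos : μ (closedBall x r) ≠ 0 := (measure_closedBall_pos μ x hr.1).ne'
        have hfin : μ (closedBall x r) ≠ ∞ := measure_closedBall_lt_top.ne
        obtain ⟨h1, h2⟩ := hVs _ (hsub.trans inter_subset_left)
        rw [hJ x hxU] at h1 h2
        rw [hνs _ measurableSet_closedBall,
          inter_eq_left.2 (hsub.trans inter_subset_right)]
        constructor
        · rw [ENNReal.div_le_iff hpos hfin, mul_assoc]; exact h1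
        · rw [← mul_div_assoc, ENNReal.le_div_iff_mul_le (Or.inl hpos) (Or.inl hfin)]; exact h2
      constructor
      · exact le_of_tendsto hx (hev.mono fun r h => h.1)
      · refine ge_of_tendsto (ENNReal.Tendsto.const_mul hx (Or.inr ?_)) (hev.mono fun r h => h.2)
        exact ENNReal.pow_ne_top ENNReal.coe_ne_top
    have hlim : ∀ A : ℝ≥0∞, Tendsto (fun K : ℝ≥0 => (K : ℝ≥0∞) ^ d * A) (𝓝[>] 1) (𝓝 A) := by
      intro A
      have h1 : Tendsto (fun K : ℝ≥0 => (K : ℝ≥0∞) ^ d) (𝓝[>] 1) (𝓝 1) := by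
        have : Continuous fun K : ℝ≥0 => (K : ℝ≥0∞) ^ d := by
          have : Continuous fun K : ℝ≥0 => ((K ^ d : ℝ≥0) : ℝ≥0∞) :=
            ENNReal.continuous_coe.comp (continuous_pow d)
          simpa using this
        simpa using (this.tendsto 1).mono_left nhdsWithin_le_nhds
      simpa using ENNReal.Tendsto.mul_const h1 (Or.inl one_ne_zero)
    refine le_antisymm ?_ ?_
    · refine ge_of_tendsto (hlim _) ?_
      filter_upwards [self_mem_nhdsWithin] with K hK using (hle K hK).1
    · refine ge_of_tendsto (hlim _) ?_
      filter_upwards [self_mem_nhdsWithin] with K hK using (hle K hK).2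
  have h1 : ν s = ∫⁻ x in s, ν.rnDeriv μ x ∂μ := by
    conv_lhs => rw [← Measure.withDensity_rnDeriv_eq ν μ hac]
    exact withDensity_apply _ hs
  rw [← inter_eq_left.2 hsU, ← hνs s hs, h1, inter_eq_left.2 hsU]
  refine lintegral_congr_ae ?_
  filter_upwards [ae_restrict_of_ae hrn, ae_restrict_mem hs] with x hx hxs using hx (hsU hxs)

end AreaFormula
section AreaFormulaNullMeasurable

variable {E F : Type*} [NormedAddCommGroup E] [NormedSpace ℝ E] [FiniteDimensional ℝ E]
  [MeasurableSpace E] [BorelSpace E] [NormedAddCommGroup F] [NormedSpace ℝ F]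
  [MeasurableSpace F] [BorelSpace F]
  {μ : Measure E} {d : ℕ} [μ.IsAddHaarMeasure]

/-- **Area formula** as an identity of measures, for null measurable subsets of a set `K` that is,
up to a null set, an open set on which `f` is an injective `C¹` map. -/
theorem euclideanHausdorffMeasure_restrict_image [Fact (Module.finrank ℝ E = d)]
    {f : E → F} {f' : E → E →L[ℝ] F}
    {K U : Set E} {C : ℝ≥0} (hU : IsOpen U) (hUb : Bornology.IsBounded U)
    (hUK : U ⊆ K) (hKU : μ (K \ U) = 0) (hlip : LipschitzOnWith C f K) (hinj : InjOn f U)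
    (hf : ∀ x ∈ U, HasStrictFDerivAt f (f' x) x)
    (hf' : ∀ x ∈ U, ∃ c, AntilipschitzWith c (f' x)) {J : E → ℝ≥0}
    (hJ : ∀ x ∈ U, ∀ s, μHE[d] (f' x '' s) = J x * μ s)
    {s : Set E} (hs : NullMeasurableSet s μ) (hsK : s ⊆ K) :
    NullMeasurableSet (f '' s) μHE[d] ∧
    (μHE[d] : Measure F).restrict (f '' s) =
      ((μ.restrict s).withDensity fun x => (J x : ℝ≥0∞)).map f := by
  -- The set `s` is replaced by a measurable subset of `U` that misses only a null set, whose image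
  -- is null by the Lipschitz bound.
  obtain ⟨t₀, ht₀s, ht₀, hae⟩ := hs.exists_measurable_subset_ae_eq
  have ht : MeasurableSet (t₀ ∩ U) := ht₀.inter hU.measurableSet
  set t := t₀ ∩ U with htdef
  have hts : t ⊆ s := inter_subset_left.trans ht₀s
  have htU : t ⊆ U := inter_subset_right
  have hnull : μ (s \ t) = 0 := by
    refine measure_mono_null (t := (s \ t₀) ∪ (K \ U)) ?_ (measure_union_null ?_ hKU)
    · intro x hx
      by_cases hxt : x ∈ t₀
      · exact Or.inr ⟨hsK hx.1, fun hxU => hx.2 ⟨hxt, hxU⟩⟩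
      · exact Or.inl ⟨hx.1, hxt⟩
    · exact (ae_le_set.1 hae.symm.le)
  have hst : t =ᵐ[μ] s := (hts.eventuallyLE).antisymm (ae_le_set.2 hnull)
  have hemb : MeasurableEmbedding (U.domRestrict f) :=
    (hlip.mono hUK).continuousOn.measurableEmbedding hU.measurableSet hinj
  have himg : ∀ A ⊆ U, f '' A = U.domRestrict f '' (Subtype.val ⁻¹' A) := by
    intro A hA
    ext y
    constructor
    · rintro ⟨x, hx, rfl⟩; exact ⟨⟨x, hA hx⟩, hx, rfl⟩
    · rintro ⟨x, hx, rfl⟩; exact ⟨x, hx, rfl⟩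
  have hftm : MeasurableSet (f '' t) := by
    rw [himg t htU]
    exact hemb.measurableSet_image.2 (measurable_subtype_coe ht)
  have hfst : f '' t =ᵐ[μHE[d]] f '' s := by
    refine ((image_mono hts).eventuallyLE).antisymm (ae_le_set.2 ?_)
    refine measure_mono_null (t := f '' (s \ t)) ?_ ?_
    · rintro _ ⟨⟨x, hx, rfl⟩, hx'⟩
      exact ⟨x, ⟨hx, fun h => hx' ⟨x, h, rfl⟩⟩, rfl⟩
    · exact euclideanHausdorffMeasure_image_eq_zero (hlip.mono (sdiff_subset.trans hsK)) hnull
  have : SFinite μ := inferInstance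
  refine ⟨hftm.nullMeasurableSet.congr hfst, ?_⟩
  rw [← Measure.restrict_congr_set hfst, ← Measure.restrict_congr_set hst]
  have hfm : AEMeasurable f ((μ.restrict t).withDensity fun x => (J x : ℝ≥0∞)) :=
    ((hlip.continuousOn.mono (htU.trans hUK)).aemeasurable ht).mono_ac
      (withDensity_absolutelyContinuous _ _)
  ext A hA
  rw [Measure.map_apply_of_aemeasurable hfm hA, Measure.restrict_apply hA, withDensity_apply',
    Measure.restrict_restrict' ht, ← image_preimage_inter]
  have hpre : MeasurableSet (f ⁻¹' A ∩ t) := by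
    have h1 : MeasurableSet (Subtype.val '' (U.domRestrict f ⁻¹' A)) :=
      hU.measurableSet.subtype_image (hemb.measurable hA)
    convert h1.inter ht using 1
    ext x
    constructor
    · rintro ⟨h, hx⟩; exact ⟨⟨⟨x, htU hx⟩, h, rfl⟩, hx⟩
    · rintro ⟨⟨y, hy, rfl⟩, hx⟩; exact ⟨hy, hx⟩
  exact euclideanHausdorffMeasure_image_eq_lintegral hU hUb (hlip.mono hUK) hinj hf hf' hJ hpre
    (inter_subset_right.trans htU)

end AreaFormulaNullMeasurable

/-! ### Linear maps on the plane with orthogonal columns -/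

section OrthogonalPartials

variable {F : Type*} [NormedAddCommGroup F] [InnerProductSpace ℝ F]

/-- A linear map on the plane with orthogonal columns `X`, `Y` scales areas by `‖X‖ ‖Y‖`. -/
theorem euclideanHausdorffMeasure_image_of_inner_eq_zero [MeasurableSpace F] [BorelSpace F]
    (L : ℝ × ℝ →L[ℝ] F) (h : inner ℝ (L (1, 0)) (L (0, 1)) = 0) (s : Set (ℝ × ℝ)) :
    μHE[2] (L '' s) = ENNReal.ofReal (‖L (1, 0)‖ * ‖L (0, 1)‖) * volume s := by
  -- The norm on `ℝ × ℝ` is the maximum norm, so the plane is first replaced by its Euclidean copy,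
  -- with the same volume. There the Gram matrix of the columns is diagonal.
  let e : EuclideanSpace ℝ (Fin 2) ≃ₗ[ℝ] ℝ × ℝ :=
    (WithLp.linearEquiv 2 ℝ (Fin 2 → ℝ)).trans (LinearEquiv.finTwoArrow ℝ ℝ)
  have hvol : volume (e ⁻¹' s) = volume s := by
    have h1 : MeasurePreserving ((MeasurableEquiv.toLp 2 (Fin 2 → ℝ)).symm.trans
        (MeasurableEquiv.finTwoArrow (α := ℝ))) volume volume :=
      (PiLp.volume_preserving_ofLp (Fin 2)).trans (volume_preserving_finTwoArrow ℝ)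
    exact h1.measure_preimage_equiv s
  let M : EuclideanSpace ℝ (Fin 2) →ₗ[ℝ] F := (L : ℝ × ℝ →ₗ[ℝ] F) ∘ₗ e.toLinearMap
  have hM := M.euclideanHausdorffMeasure_image_eq_normDet_mul_volume (e ⁻¹' s)
  have h0 : M (EuclideanSpace.basisFun (Fin 2) ℝ 0) = L (1, 0) := by simp [M, e]
  have h1 : M (EuclideanSpace.basisFun (Fin 2) ℝ 1) = L (0, 1) := by simp [M, e]
  have hdet : M.normDet = ‖L (1, 0)‖ * ‖L (0, 1)‖ := by
    have hg := M.normDet_sq_eq_det_gram (EuclideanSpace.basisFun (Fin 2) ℝ)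
    rw [Matrix.det_fin_two] at hg
    simp only [Matrix.gram_apply, h0, h1, h, real_inner_self_eq_norm_sq, zero_mul, sub_zero] at hg
    have h2 : M.normDet ^ 2 = (‖L (1, 0)‖ * ‖L (0, 1)‖) ^ 2 := by
      rw [mul_pow]; exact hg
    exact (pow_left_inj₀ M.normDet_nonneg (by positivity) two_ne_zero).1 h2
  have himg : M '' (e ⁻¹' s) = L '' s := by
    have : (M : EuclideanSpace ℝ (Fin 2) → F) = L ∘ e := rfl
    rw [this, image_comp, image_preimage_eq s e.surjective]
  rw [himg, hvol, hdet] at hM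
  simpa using hM

theorem exists_antilipschitzWith_of_inner_eq_zero (L : ℝ × ℝ →L[ℝ] F)
    (h : inner ℝ (L (1, 0)) (L (0, 1)) = 0) (hX : L (1, 0) ≠ 0) (hY : L (0, 1) ≠ 0) :
    ∃ c, AntilipschitzWith c L := by
  have hker : (L : ℝ × ℝ →ₗ[ℝ] F).ker = ⊥ := by
    rw [LinearMap.ker_eq_bot']
    rintro ⟨a, b⟩ hab
    have hL : a • L (1, 0) + b • L (0, 1) = 0 := by
      rw [← map_smul, ← map_smul, ← map_add]
      simpa using hab
    have h1 := congrArg (fun z => inner ℝ (L (1, 0)) z) hL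
    have h2 := congrArg (fun z => inner ℝ z (L (0, 1))) hL
    simp only [inner_add_right, inner_smul_right, h, mul_zero, add_zero, inner_zero_right,
      inner_add_left, inner_smul_left, zero_add, inner_zero_left] at h1 h2
    have ha : a = 0 := (mul_eq_zero.1 h1).resolve_right (inner_self_ne_zero.2 hX)
    have hb : b = 0 := by
      have := (mul_eq_zero.1 h2).resolve_right (inner_self_ne_zero.2 hY)
      simpa using this
    rw [ha, hb]; rfl
  obtain ⟨c, -, hc⟩ := LinearMap.exists_antilipschitzWith (L : ℝ × ℝ →ₗ[ℝ] F) hker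
  exact ⟨c, hc⟩

end OrthogonalPartials
/-- Differentiation under the integral sign for an integrand that is `C¹` near a compact set. -/
theorem hasDerivAt_setIntegral_of_contDiffAt {V : Type*} [NormedAddCommGroup V] [NormedSpace ℝ V]
    [MeasurableSpace V] [BorelSpace V] [SecondCountableTopology V]
    {μ : Measure V} [IsFiniteMeasureOnCompacts μ] {K U : Set V} {I : Set ℝ}
    (hK : IsCompact K) (hI : IsOpen I) (hUK : U ⊆ K) {u : V → ℝ} (hu : ContinuousOn u K)
    {g : V → ℝ → ℝ}
    (hg : ∀ q ∈ K, ∀ s ∈ I, ContDiffAt ℝ 1 (fun z : V × ℝ => g z.1 z.2) (q, s)) {t : ℝ}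
    (ht : t ∈ I) :
    IntegrableOn (fun q => u q * g q t) U μ ∧
    IntegrableOn (fun q => u q * deriv (g q) t) U μ ∧
    HasDerivAt (fun s => ∫ q in U, u q * g q s ∂μ) (∫ q in U, u q * deriv (g q) t ∂μ) t := by
  set g' : V → ℝ → ℝ := fun q s => fderiv ℝ (fun z : V × ℝ => g z.1 z.2) (q, s) (0, 1) with hg'
  have hderiv : ∀ q ∈ K, ∀ s ∈ I, HasDerivAt (g q) (g' q s) s := by
    intro q hq s hs
    have h1 := ((hg q hq s hs).differentiableAt one_ne_zero).hasFDerivAt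
    have h2 : HasDerivAt (fun s : ℝ => ((q, s) : V × ℝ)) (0, 1) s :=
      (hasDerivAt_const s q).prodMk (hasDerivAt_id s)
    exact h1.comp_hasDerivAt s h2
  have hcont : ∀ q ∈ K, ∀ s ∈ I, ContinuousAt (fun z : V × ℝ => g' z.1 z.2) (q, s) := by
    intro q hq s hs
    have h1 : ContinuousAt (fderiv ℝ (fun z : V × ℝ => g z.1 z.2)) (q, s) :=
      (hg q hq s hs).continuousAt_fderiv one_ne_zero
    exact h1.clm_apply continuousAt_const
  have hslice : ∀ {h : V × ℝ → ℝ} {s : ℝ}, (∀ q ∈ K, ContinuousAt h (q, s)) →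
      ContinuousOn (fun q => h (q, s)) K := by
    intro h s hh q hq
    have h2 : ContinuousAt (fun q : V => (q, s)) q := by fun_prop
    exact (ContinuousAt.comp (f := fun q : V => (q, s)) (hh q hq) h2).continuousWithinAt
  have hmeas : ∀ {h : V → ℝ}, ContinuousOn h K → AEStronglyMeasurable h (μ.restrict U) :=
    fun hh => (hh.aestronglyMeasurable hK.measurableSet).mono_measure (Measure.restrict_mono_set μ hUK)
  have hgc : ∀ s ∈ I, ContinuousOn (fun q => u q * g q s) K := fun s hs =>
    hu.mul (hslice fun q hq => (hg q hq s hs).continuousAt)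
  have hgc' : ContinuousOn (fun q => u q * g' q t) K :=
    hu.mul (hslice (h := fun z => g' z.1 z.2) fun q hq => hcont q hq t ht)
  -- On the compact product of `K` and a closed time interval the continuous time derivative is
  -- bounded, so a constant serves as the dominating function.
  obtain ⟨ε, hε, hεI⟩ := Metric.nhds_basis_closedBall.mem_iff.1 (hI.mem_nhds ht)
  have hprod : IsCompact (K ×ˢ closedBall t ε) := hK.prod (isCompact_closedBall t ε)
  have hbig : ContinuousOn (fun z : V × ℝ => u z.1 * g' z.1 z.2) (K ×ˢ closedBall t ε) := by
    refine (hu.comp continuousOn_fst fun z hz => hz.1).mul fun z hz => ?_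
    exact (hcont z.1 hz.1 z.2 (hεI hz.2)).continuousWithinAt
  obtain ⟨C, hC⟩ := hprod.exists_bound_of_continuousOn hbig
  have hint0 : IntegrableOn (fun q => u q * g q t) U μ :=
    ((hgc t ht).integrableOn_compact hK).mono_set hUK
  -- `U` is not assumed measurable; the measurability of `K` suffices.
  have hres : ∀ᵐ q ∂μ.restrict U, q ∈ K :=
    (ae_restrict_mem hK.measurableSet).filter_mono (ae_mono (Measure.restrict_mono_set μ hUK))
  have hmain := hasDerivAt_integral_of_dominated_loc_of_deriv_le (μ := μ.restrict U)
    (F := fun s q => u q * g q s) (F' := fun s q => u q * g' q s) (x₀ := t) (s := closedBall t ε)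
    (bound := fun _ => C) (closedBall_mem_nhds t hε)
    (by
      filter_upwards [hI.mem_nhds ht] with s hs
      exact hmeas (hgc s hs))
    hint0 (hmeas hgc')
    (by filter_upwards [hres] with q hq s hs using hC (q, s) ⟨hq, hs⟩)
    ((continuousOn_const.integrableOn_compact hK).mono_set hUK)
    (by filter_upwards [hres] with q hq s hs using (hderiv q hq s (hεI hs)).const_mul _)
  have hcongr : (fun q => u q * deriv (g q) t) =ᵐ[μ.restrict U] fun q => u q * g' q t := by
    filter_upwards [hres] with q hq
    rw [(hderiv q hq t ht).deriv]
  refine ⟨hint0, hmain.1.congr hcongr.symm, ?_⟩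
  rw [integral_congr_ae hcongr]
  exact hmain.2

end MeasureTheory

/-! ### Parameter domains and charts with a density of product form -/

namespace DoubleBubble

/-- The interior of the parameter domain. -/
def openDomain : Set (ℝ × ℝ) := Ioo (0 : ℝ) 1 ×ˢ Ioo (0 : ℝ) (2 * Real.pi)

theorem isOpen_openDomain : IsOpen openDomain := isOpen_Ioo.prod isOpen_Ioo

theorem isCompact_closedDomain : IsCompact closedDomain := isCompact_Icc.prod isCompact_Icc

theorem convex_closedDomain : Convex ℝ closedDomain := (convex_Icc _ _).prod (convex_Icc _ _)

theorem openDomain_subset_closedDomain : openDomain ⊆ closedDomain :=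
  prod_mono Ioo_subset_Icc_self Ioo_subset_Icc_self

theorem capDomain_subset_closedDomain : capDomain ⊆ closedDomain :=
  prod_mono Ico_subset_Icc_self Subset.rfl

theorem openDomain_subset_capDomain : openDomain ⊆ capDomain :=
  prod_mono Ioo_subset_Ico_self Ioo_subset_Icc_self

theorem volume_closedDomain_diff_openDomain :
    volume (closedDomain \ openDomain) = 0 := by
  have h : openDomain =ᵐ[volume] closedDomain := by
    rw [openDomain, closedDomain, Measure.volume_eq_prod]
    exact Measure.set_prod_ae_eq Ioo_ae_eq_Icc Ioo_ae_eq_Icc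
  exact ae_le_set.1 h.symm.le

theorem nullMeasurableSet_capDomain : NullMeasurableSet capDomain :=
  (measurableSet_Ico.prod measurableSet_Icc).nullMeasurableSet

theorem nullMeasurableSet_closedDomain : NullMeasurableSet closedDomain :=
  isCompact_closedDomain.measurableSet.nullMeasurableSet

theorem eventually_mem_openDomain {φ : ℝ × ℝ → E3} {Γ : Set E3} {q : ℝ × ℝ}
    (hq : q ∈ openDomain) (hφ : ∀ p ∈ openDomain, φ p ∈ Γ) : ∀ᶠ p in 𝓝 q, φ p ∈ Γ := by
  filter_upwards [isOpen_openDomain.mem_nhds hq] with p hp using hφ p hp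

/-- A time dependent parametrization over `closedDomain` that is `C¹` and, on the interior,
injective with orthogonal partial derivatives; its area density is `j(s) u(q)`. -/
structure IsFlowChart (I : Set ℝ) (φ : ℝ × ℝ → ℝ → E3) (j : ℝ → ℝ) (u : ℝ × ℝ → ℝ) : Prop where
  smooth : ∀ q ∈ closedDomain, ∀ s ∈ I,
    ContDiffAt ℝ 1 (fun z : (ℝ × ℝ) × ℝ => φ z.1 z.2) (q, s)
  injOn : ∀ s ∈ I, InjOn (fun q => φ q s) openDomain
  inner_eq_zero : ∀ s ∈ I, ∀ q ∈ openDomain,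
    inner ℝ (fderiv ℝ (fun q => φ q s) q (1, 0)) (fderiv ℝ (fun q => φ q s) q (0, 1)) = 0
  norm_mul_norm : ∀ s ∈ I, ∀ q ∈ openDomain,
    ‖fderiv ℝ (fun q => φ q s) q (1, 0)‖ * ‖fderiv ℝ (fun q => φ q s) q (0, 1)‖ = j s * u q
  density_contDiffOn : ContDiffOn ℝ 1 j I
  density_pos : ∀ s ∈ I, 0 < j s
  weight_continuousOn : ContinuousOn u closedDomain
  weight_nonneg : ∀ q ∈ closedDomain, 0 ≤ u q
  weight_pos : ∀ q ∈ openDomain, 0 < u q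

namespace IsFlowChart

variable {I : Set ℝ} {φ : ℝ × ℝ → ℝ → E3} {j : ℝ → ℝ} {u : ℝ × ℝ → ℝ}

theorem contDiffAt (h : IsFlowChart I φ j u) {s : ℝ} (hs : s ∈ I) {q : ℝ × ℝ}
    (hq : q ∈ closedDomain) : ContDiffAt ℝ 1 (fun q => φ q s) q :=
  ContDiffAt.comp (f := fun q : ℝ × ℝ => (q, s)) q (h.smooth q hq s hs)
    (contDiffAt_id.prodMk contDiffAt_const)

theorem continuousOn (h : IsFlowChart I φ j u) {s : ℝ} (hs : s ∈ I) :
    ContinuousOn (fun q => φ q s) closedDomain := fun _ hq =>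
  (h.contDiffAt hs hq).continuousAt.continuousWithinAt

theorem hasDerivAt (h : IsFlowChart I φ j u) {s : ℝ} (hs : s ∈ I) {q : ℝ × ℝ}
    (hq : q ∈ closedDomain) : HasDerivAt (φ q) (deriv (φ q) s) s := by
  have h1 : ContDiffAt ℝ 1 (φ q) s :=
    ContDiffAt.comp (f := fun s : ℝ => (q, s)) s (h.smooth q hq s hs)
      (contDiffAt_const.prodMk contDiffAt_id)
  exact (h1.differentiableAt one_ne_zero).hasDerivAt

theorem exists_lipschitzOnWith (h : IsFlowChart I φ j u) {s : ℝ} (hs : s ∈ I) :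
    ∃ C, LipschitzOnWith C (fun q => φ q s) closedDomain :=
  ContDiffOn.exists_lipschitzOnWith (n := 1)
    (fun _ hq => (h.contDiffAt hs hq).contDiffWithinAt) one_ne_zero convex_closedDomain
    isCompact_closedDomain

instance fact_finrank_prod : Fact (Module.finrank ℝ (ℝ × ℝ) = 2) := ⟨by simp⟩

theorem measure_image_eq_zero (h : IsFlowChart I φ j u) {s : ℝ} (hs : s ∈ I) {U : Set (ℝ × ℝ)}
    (hU : U ⊆ closedDomain) (h0 : volume U = 0) :
    μHE[2] ((fun q => φ q s) '' U) = 0 := by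
  obtain ⟨C, hC⟩ := h.exists_lipschitzOnWith hs
  exact euclideanHausdorffMeasure_image_eq_zero (hC.mono hU) h0

/-- Positivity of `j u` makes both partial derivatives nonzero on the open rectangle, and
orthogonality makes the product of their norms the Jacobian, so the area formula applies there. The
edge, where a chart may degenerate or overlap itself, is negligible. -/
theorem restrict_image (h : IsFlowChart I φ j u) {s : ℝ} (hs : s ∈ I) {U : Set (ℝ × ℝ)}
    (hU : NullMeasurableSet U) (hUK : U ⊆ closedDomain) :
    NullMeasurableSet ((fun q => φ q s) '' U) μHE[2] ∧
    (μHE[2] : Measure E3).restrict ((fun q => φ q s) '' U) =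
      ((volume.restrict U).withDensity fun q => ((j s * u q).toNNReal : ℝ≥0∞)).map
        (fun q => φ q s) := by
  obtain ⟨C, hC⟩ := h.exists_lipschitzOnWith hs
  refine euclideanHausdorffMeasure_restrict_image (f' := fun q => fderiv ℝ (fun q => φ q s) q)
    isOpen_openDomain
    (isCompact_closedDomain.isBounded.subset openDomain_subset_closedDomain)
    openDomain_subset_closedDomain volume_closedDomain_diff_openDomain hC (h.injOn s hs)
    (fun q hq => (h.contDiffAt hs (openDomain_subset_closedDomain hq)).hasStrictFDerivAt
      one_ne_zero) (fun q hq => ?_) (fun q hq A => ?_) hU hUK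
  · have hpos : 0 < j s * u q := mul_pos (h.density_pos s hs) (h.weight_pos q hq)
    rw [← h.norm_mul_norm s hs q hq] at hpos
    refine exists_antilipschitzWith_of_inner_eq_zero _ (h.inner_eq_zero s hs q hq) ?_ ?_
    · exact norm_ne_zero_iff.1 (left_ne_zero_of_mul hpos.ne')
    · exact norm_ne_zero_iff.1 (right_ne_zero_of_mul hpos.ne')
  · rw [euclideanHausdorffMeasure_image_of_inner_eq_zero _ (h.inner_eq_zero s hs q hq),
      h.norm_mul_norm s hs q hq]
    rfl

theorem nullMeasurableSet_image (h : IsFlowChart I φ j u) {s : ℝ} (hs : s ∈ I) {U : Set (ℝ × ℝ)}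
    (hU : NullMeasurableSet U) (hUK : U ⊆ closedDomain) :
    NullMeasurableSet ((fun q => φ q s) '' U) μHE[2] := (h.restrict_image hs hU hUK).1

/-- Change of variables in surface integrals. -/
theorem setIntegral_image (h : IsFlowChart I φ j u) {s : ℝ} (hs : s ∈ I) {U : Set (ℝ × ℝ)}
    (hU : NullMeasurableSet U) (hUK : U ⊆ closedDomain) {g : E3 → ℝ} (hg : Measurable g) :
    (IntegrableOn g ((fun q => φ q s) '' U) μHE[2] ↔
      IntegrableOn (fun q => u q * (j s * g (φ q s))) U) ∧
    ∫ x in (fun q => φ q s) '' U, g x ∂μHE[2] = ∫ q in U, u q * (j s * g (φ q s)) := by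
  have hres : ∀ᵐ q ∂volume.restrict U, q ∈ closedDomain :=
    (ae_restrict_mem isCompact_closedDomain.measurableSet).filter_mono
      (ae_mono (Measure.restrict_mono_set _ hUK))
  have hmono := Measure.restrict_mono_set (volume : Measure (ℝ × ℝ)) hUK
  have hφ : AEMeasurable (fun q => φ q s) (volume.restrict U) :=
    ((h.continuousOn hs).aemeasurable isCompact_closedDomain.measurableSet).mono_measure hmono
  have hφ' : AEMeasurable (fun q => φ q s)
      ((volume.restrict U).withDensity fun q => ((j s * u q).toNNReal : ℝ≥0∞)) :=
    hφ.mono_ac (withDensity_absolutelyContinuous _ _)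
  have hJ : AEMeasurable (fun q => (j s * u q).toNNReal) (volume.restrict U) :=
    (((h.weight_continuousOn.aemeasurable isCompact_closedDomain.measurableSet).const_mul
      (j s)).mono_measure hmono).real_toNNReal
  have hcongr : (fun q => (j s * u q).toNNReal • g (φ q s)) =ᵐ[volume.restrict U]
      fun q => u q * (j s * g (φ q s)) := by
    filter_upwards [hres] with q hq
    rw [NNReal.smul_def, Real.coe_toNNReal _
      (mul_nonneg (h.density_pos s hs).le (h.weight_nonneg q hq)), smul_eq_mul]
    ring
  constructor
  · rw [IntegrableOn, (h.restrict_image hs hU hUK).2,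
      integrable_map_measure hg.aestronglyMeasurable hφ',
      integrable_withDensity_iff_integrable_smul₀ hJ]
    exact integrable_congr hcongr
  · rw [(h.restrict_image hs hU hUK).2, integral_map hφ' hg.aestronglyMeasurable,
      integral_withDensity_eq_integral_smul₀ hJ]
    exact integral_congr_ae hcongr

end IsFlowChart

/-- The chain rule in space-time. The curve `γ` has to follow `w` at the single time `t` only. -/
theorem hasDerivAt_comp_materialDeriv {f : E3 → ℝ → ℝ}
    (hf : ContDiff ℝ 1 (fun q : E3 × ℝ => f q.1 q.2)) {w : E3 → ℝ → E3} {γ : ℝ → E3} {t : ℝ}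
    (hγ : HasDerivAt γ (w (γ t) t) t) :
    HasDerivAt (fun s => f (γ s) s) (materialDeriv w f (γ t) t) t := by
  have hF := ((hf.differentiable one_ne_zero) (γ t, t)).hasFDerivAt
  set D := fderiv ℝ (fun q : E3 × ℝ => f q.1 q.2) (γ t, t)
  have h1 : HasDerivAt (fun s => f (γ s) s) (D (w (γ t) t, 1)) t :=
    HasFDerivAt.comp_hasDerivAt (f := fun s => (γ s, s)) t hF (hγ.prodMk (hasDerivAt_id t))
  have h2 : HasDerivAt (fun s => f (γ t) s) (D (0, 1)) t :=
    hF.comp_hasDerivAt t ((hasDerivAt_const t (γ t)).prodMk (hasDerivAt_id t))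
  have h3 : HasFDerivAt (fun y => f y t) (D.comp (ContinuousLinearMap.inl ℝ E3 ℝ)) (γ t) :=
    HasFDerivAt.comp (f := fun y => (y, t)) (γ t) hF (hasFDerivAt_prodMk_left (γ t) t)
  convert h1 using 1
  rw [materialDeriv, h2.deriv, h3.fderiv]
  have hv : w (γ t) t = ∑ i, w (γ t) t i • EuclideanSpace.single i (1 : ℝ) := by
    have := (EuclideanSpace.basisFun (Fin 3) ℝ).sum_repr (w (γ t) t)
    simpa using this.symm
  have hsplit : (w (γ t) t, (1 : ℝ)) = (0, 1) + ContinuousLinearMap.inl ℝ E3 ℝ (w (γ t) t) := by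
    simp
  rw [hsplit, map_add]
  congr 1
  conv_rhs => rw [hv]
  simp only [map_sum, map_smul, smul_eq_mul]
  rfl

/-- The material derivative is the space-time derivative of `f` applied to `(w, 1)`, hence a
continuous function of the point and of the value of `w`. -/
theorem measurable_materialDeriv {f : E3 → ℝ → ℝ}
    (hf : ContDiff ℝ 1 (fun q : E3 × ℝ => f q.1 q.2)) {w : E3 → ℝ → E3} {t : ℝ}
    (hw : Measurable fun x => w x t) : Measurable fun x => materialDeriv w f x t := by
  have hd : ∀ x, materialDeriv w f x t =
      fderiv ℝ (fun q : E3 × ℝ => f q.1 q.2) (x, t) (w x t, 1) := by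
    intro x
    -- The straight line through `x` with velocity `w x t` is a test curve: comparing two forms of
    -- the chain rule along it identifies the material derivative.
    have hγ : HasDerivAt (fun s => x + (s - t) • w x t) (w x t) t := by
      have := (((hasDerivAt_id t).sub_const t).smul_const (w x t)).const_add x
      simpa using this
    have hx : x + (t - t) • w x t = x := by simp
    have h1 := hasDerivAt_comp_materialDeriv hf (w := w)
      (γ := fun s => x + (s - t) • w x t) (t := t) (by simpa using hγ)
    have hF := ((hf.differentiable one_ne_zero) (x, t)).hasFDerivAt
    rw [← hx] at hF
    have h2 := HasFDerivAt.comp_hasDerivAt (f := fun s => (x + (s - t) • w x t, s)) t hF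
      (hγ.prodMk (hasDerivAt_id t))
    have := h1.unique h2
    simpa using this
  simp_rw [hd]
  have hc : Continuous (fderiv ℝ (fun q : E3 × ℝ => f q.1 q.2)) := hf.continuous_fderiv one_ne_zero
  have h1 : Continuous fun z : E3 × E3 =>
      fderiv ℝ (fun q : E3 × ℝ => f q.1 q.2) (z.1, t) (z.2, 1) := by fun_prop
  exact h1.measurable.comp (measurable_id.prodMk hw)

/-- **Transport theorem** for a portion of the surface that is parametrized by a single chart. -/
theorem IsFlowChart.transport {I : Set ℝ} (hI : IsOpen I) {φ : ℝ × ℝ → ℝ → E3} {j : ℝ → ℝ}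
    {u : ℝ × ℝ → ℝ} (h : IsFlowChart I φ j u) {t : ℝ} (ht : t ∈ I) {w : E3 → ℝ → E3}
    (hw : ∀ q ∈ closedDomain, w (φ q t) t = deriv (φ q) t) (hwm : Measurable fun x => w x t)
    {U : Set (ℝ × ℝ)} (hU : NullMeasurableSet U) (hUK : U ⊆ closedDomain) {f : E3 → ℝ → ℝ}
    (hf : ContDiff ℝ 1 (fun q : E3 × ℝ => f q.1 q.2)) :
    IntegrableOn (fun x => f x t) ((fun q => φ q t) '' U) μHE[2] ∧
    IntegrableOn (fun x => materialDeriv w f x t + deriv j t / j t * f x t)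
      ((fun q => φ q t) '' U) μHE[2] ∧
    HasDerivAt (fun s => ∫ x in (fun q => φ q s) '' U, f x s ∂μHE[2])
      (∫ x in (fun q => φ q t) '' U,
        (materialDeriv w f x t + deriv j t / j t * f x t) ∂μHE[2]) t := by
  have hfm : ∀ s, Measurable fun x => f x s := fun s =>
    (hf.continuous.comp (by fun_prop : Continuous fun x : E3 => (x, s))).measurable
  have hjd : HasDerivAt j (deriv j t) t :=
    ((h.density_contDiffOn.contDiffAt (hI.mem_nhds ht)).differentiableAt one_ne_zero).hasDerivAt
  obtain ⟨h1, h2, h3⟩ := hasDerivAt_setIntegral_of_contDiffAt (μ := volume) (U := U)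
    isCompact_closedDomain hI hUK h.weight_continuousOn (g := fun q s => j s * f (φ q s) s)
    (fun q hq s hs => by
      have ha : ContDiffAt ℝ 1 (fun z : (ℝ × ℝ) × ℝ => j z.2) (q, s) :=
        ContDiffAt.comp (f := fun z : (ℝ × ℝ) × ℝ => z.2) (q, s)
          (h.density_contDiffOn.contDiffAt (hI.mem_nhds hs)) contDiffAt_snd
      have hb : ContDiffAt ℝ 1 (fun z : (ℝ × ℝ) × ℝ => f (φ z.1 z.2) z.2) (q, s) :=
        ContDiffAt.comp (f := fun z : (ℝ × ℝ) × ℝ => (φ z.1 z.2, z.2))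
          (g := fun q : E3 × ℝ => f q.1 q.2) (q, s) hf.contDiffAt
          ((h.smooth q hq s hs).prodMk contDiffAt_snd)
      exact ha.mul hb) ht
  have hres : ∀ᵐ q ∂volume.restrict U, q ∈ closedDomain :=
    (ae_restrict_mem isCompact_closedDomain.measurableSet).filter_mono
      (ae_mono (Measure.restrict_mono_set _ hUK))
  have hcongr : (fun q => u q * deriv (fun s => j s * f (φ q s) s) t) =ᵐ[volume.restrict U]
      fun q => u q * (j t * (materialDeriv w f (φ q t) t + deriv j t / j t * f (φ q t) t)) := by
    filter_upwards [hres] with q hq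
    have hγ : HasDerivAt (φ q) (w (φ q t) t) t := by
      rw [hw q hq]; exact h.hasDerivAt ht hq
    -- The product rule; pulling `j t` out of both terms leaves the logarithmic derivative of `j` as
    -- the factor of `f`.
    have hprod : HasDerivAt (fun s => j s * f (φ q s) s) _ t :=
      hjd.mul (hasDerivAt_comp_materialDeriv hf hγ)
    rw [hprod.deriv]
    have := (h.density_pos t ht).ne'
    field_simp
    ring
  obtain ⟨i1, -⟩ := h.setIntegral_image ht hU hUK (hfm t)
  obtain ⟨i2, e2⟩ := h.setIntegral_image ht hU hUK
    (g := fun x => materialDeriv w f x t + deriv j t / j t * f x t)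
    ((measurable_materialDeriv hf hwm).add ((hfm t).const_mul _))
  refine ⟨i1.2 h1, i2.2 (h2.congr hcongr), ?_⟩
  rw [e2, ← integral_congr_ae hcongr]
  refine h3.congr_of_eventuallyEq ?_
  filter_upwards [hI.mem_nhds ht] with s hs
  exact (h.setIntegral_image hs hU hUK (hfm s)).2

theorem inner_eq_sum_three (X Y : E3) : inner ℝ X Y = X 0 * Y 0 + X 1 * Y 1 + X 2 * Y 2 := by
  simp [PiLp.inner_apply, Fin.sum_univ_three, mul_comm]

theorem norm_sq_eq_sum_three (X : E3) : ‖X‖ ^ 2 = X 0 ^ 2 + X 1 ^ 2 + X 2 ^ 2 := by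
  simp [EuclideanSpace.norm_sq_eq, Fin.sum_univ_three]

/-! ### The surface divergence in a chart -/

/-- In three-space, two orthogonal nonzero vectors that are orthogonal to a unit vector `n` span
the orthogonal complement of `n`. -/
theorem exists_eq_of_inner_eq_zero {n X Y v : E3} (hn : n ≠ 0) (hX : X ≠ 0) (hY : Y ≠ 0)
    (hnX : inner ℝ n X = 0) (hnY : inner ℝ n Y = 0) (hXY : inner ℝ X Y = 0)
    (hnv : inner ℝ n v = 0) : ∃ α β : ℝ, v = α • X + β • Y := by
  set α := inner ℝ X v / inner ℝ X X
  set β := inner ℝ Y v / inner ℝ Y Y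
  refine ⟨α, β, ?_⟩
  by_contra hne
  have hr : v - (α • X + β • Y) ≠ 0 := sub_ne_zero.2 hne
  have hXX : inner ℝ X X ≠ 0 := inner_self_ne_zero.2 hX
  have hYY : inner ℝ Y Y ≠ 0 := inner_self_ne_zero.2 hY
  have hYX : inner ℝ Y X = 0 := by rw [real_inner_comm]; exact hXY
  have h1 : inner ℝ n (v - (α • X + β • Y)) = 0 := by
    simp [inner_sub_right, inner_add_right, inner_smul_right, hnv, hnX, hnY]
  have h2 : inner ℝ X (v - (α • X + β • Y)) = 0 := by
    simp only [inner_sub_right, inner_add_right, inner_smul_right, hXY, α]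
    field_simp
    ring
  have h3 : inner ℝ Y (v - (α • X + β • Y)) = 0 := by
    simp only [inner_sub_right, inner_add_right, inner_smul_right, hYX, β]
    field_simp
    ring
  -- A nonzero remainder of `v` after its projection would be a fourth orthogonal direction in
  -- three-space.
  have hli : LinearIndependent ℝ ![n, X, Y, v - (α • X + β • Y)] := by
    refine linearIndependent_of_ne_zero_of_inner_eq_zero (𝕜 := ℝ) ?_ ?_
    · intro i; fin_cases i <;> assumption
    · intro i k hik
      fin_cases i <;> fin_cases k <;> first | exact absurd rfl hik | assumption |
        (rw [real_inner_comm]; assumption)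
  have := hli.fintype_card_le_finrank
  simp at this

/-- The surface divergence of a field that coincides on the surface `Γ`, near a point inside a
chart, with a differentiable field `W`. -/
theorem surfDiv_eq_of_eventuallyEq {Γ : Set E3} {n : E3 → E3} {w W : E3 → E3}
    {G : E3 →L[ℝ] E3} {φ : ℝ × ℝ → E3} {L : ℝ × ℝ →L[ℝ] E3} {q : ℝ × ℝ}
    (hφ : HasFDerivAt φ L q) (hmem : ∀ᶠ p in 𝓝 q, φ p ∈ Γ)
    (hw : w =ᶠ[𝓝[Γ] (φ q)] W) (hW : HasFDerivAt W G (φ q))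
    (hn : ‖n (φ q)‖ = 1) (hX : L (1, 0) ≠ 0) (hY : L (0, 1) ≠ 0)
    (hnX : inner ℝ (n (φ q)) (L (1, 0)) = 0) (hnY : inner ℝ (n (φ q)) (L (0, 1)) = 0)
    (hXY : inner ℝ (L (1, 0)) (L (0, 1)) = 0) :
    DifferentiableWithinAt ℝ w Γ (φ q) ∧
    surfDiv Γ n w (φ q) =
      ∑ j : Fin 3, G (EuclideanSpace.single j 1 - n (φ q) j • n (φ q)) j := by
  set x := φ q with hx
  have hxΓ : x ∈ Γ := hmem.self_of_nhds
  have hwx : w x = W x := hw.self_of_nhdsWithin hxΓ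
  have hG : HasFDerivWithinAt w G Γ x := hW.hasFDerivWithinAt.congr_of_eventuallyEq hw hwx
  refine ⟨hG.differentiableWithinAt, Finset.sum_congr rfl fun j _ => ?_⟩
  have hGj : HasFDerivWithinAt (fun y => w y j) (PiLp.proj 2 (fun _ : Fin 3 => ℝ) j ∘SL G) Γ x :=
    hasFDerivWithinAt_euclidean.1 hG j
  have hDj := hGj.differentiableWithinAt.hasFDerivWithinAt
  set D := fderivWithin ℝ (fun y => w y j) Γ x with hD
  have hsum : surfDeriv Γ n (fun y => w y j) j x = D (EuclideanSpace.single j 1 - n x j • n x) := by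
    rw [surfDeriv, ← hD]
    have hv : EuclideanSpace.single j 1 - n x j • n x =
        ∑ i : Fin 3, ((if i = j then 1 else 0) - n x i * n x j) •
          EuclideanSpace.single i (1 : ℝ) := by
      ext k
      simp [Finset.sum_apply, Pi.single_apply, mul_comm]
    rw [hv]
    simp only [map_sum, map_smul, smul_eq_mul]
  rw [hsum]
  have horth : inner ℝ (n x) (EuclideanSpace.single j 1 - n x j • n x) = 0 := by
    rw [inner_sub_right, inner_smul_right, real_inner_self_eq_norm_sq, hn,
      EuclideanSpace.inner_single_right]
    simp
  obtain ⟨α, β, hαβ⟩ := exists_eq_of_inner_eq_zero (norm_ne_zero_iff.1 (by rw [hn]; simp)) hX hY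
    hnX hnY hXY horth
  have hrange : EuclideanSpace.single j 1 - n x j • n x = L (α, β) := by
    rw [hαβ, ← map_smul, ← map_smul, ← map_add]
    simp
  -- `fderivWithin` is some derivative within `Γ`, possibly different from `G`, but any two agree on
  -- the tangent cone. The cone contains the range of `L` because `φ` maps a full neighbourhood of
  -- `q` into `Γ`.
  have hcone : L (α, β) ∈ tangentConeAt ℝ Γ x := by
    have h1 := (hφ.hasFDerivWithinAt (s := {p | φ p ∈ Γ})).mapsTo_tangent_cone
    rw [tangentConeAt_of_mem_nhds hmem] at h1
    refine tangentConeAt_mono ?_ (h1 (mem_univ (α, β)))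
    rintro _ ⟨p, hp, rfl⟩
    exact hp
  rw [hrange]
  exact hDj.unique_on hGj hcone

/-! ### Axially symmetric vector fields -/

/-- The axially symmetric vector field with axial component `g` and radial component proportional
to the distance from the axis with factor `c`. -/
def axialField (g c : ℝ → ℝ) (x : E3) : E3 := !₂[g (x 0), c (x 0) * x 1, c (x 0) * x 2]

theorem measurable_axialField {g c : ℝ → ℝ} (hg : Measurable g) (hc : Measurable c) :
    Measurable (axialField g c) := by
  unfold axialField
  fun_prop

theorem exists_hasFDerivAt_axialField {g c : ℝ → ℝ} {g' c' : ℝ} {x : E3}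
    (hg : HasDerivAt g g' (x 0)) (hc : HasDerivAt c c' (x 0)) :
    ∃ G : E3 →L[ℝ] E3, HasFDerivAt (axialField g c) G x ∧ ∀ v : E3, G v =
      !₂[g' * v 0, c' * v 0 * x 1 + c (x 0) * v 1, c' * v 0 * x 2 + c (x 0) * v 2] := by
  let P : Fin 3 → E3 →L[ℝ] ℝ := fun i => PiLp.proj 2 (fun _ : Fin 3 => ℝ) i
  have hP : ∀ i, HasFDerivAt (fun y : E3 => y i) (P i) x := fun i => (P i).hasFDerivAt
  have h0 : HasFDerivAt (fun y : E3 => g (y 0)) (g' • P 0) x := hg.comp_hasFDerivAt x (hP 0)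
  have hc0 : HasFDerivAt (fun y : E3 => c (y 0)) (c' • P 0) x := hc.comp_hasFDerivAt x (hP 0)
  have h1 := hc0.mul (hP 1)
  have h2 := hc0.mul (hP 2)
  let H : Fin 3 → E3 →L[ℝ] ℝ :=
    ![g' • P 0, c (x 0) • P 1 + x 1 • c' • P 0, c (x 0) • P 2 + x 2 • c' • P 0]
  let G : E3 →L[ℝ] E3 :=
    ((PiLp.continuousLinearEquiv 2 ℝ (fun _ : Fin 3 => ℝ)).symm : (Fin 3 → ℝ) →L[ℝ] E3) ∘SL
      ContinuousLinearMap.pi H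
  refine ⟨G, ?_, fun v => ?_⟩
  · rw [← hasFDerivWithinAt_univ, hasFDerivWithinAt_euclidean]
    intro i
    rw [hasFDerivWithinAt_univ]
    fin_cases i
    · exact h0
    · exact h1
    · exact h2
  · ext i
    fin_cases i
    · simp [G, H, P]
    · simp [G, H, P]; ring
    · simp [G, H, P]; ring

/-! ### Surfaces of revolution -/

theorem hasDerivAt_vec3 {f₀ f₁ f₂ : ℝ → ℝ} {d₀ d₁ d₂ t : ℝ} (h₀ : HasDerivAt f₀ d₀ t)
    (h₁ : HasDerivAt f₁ d₁ t) (h₂ : HasDerivAt f₂ d₂ t) :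
    HasDerivAt (fun s => (!₂[f₀ s, f₁ s, f₂ s] : E3)) !₂[d₀, d₁, d₂] t := by
  have h : HasDerivAt (fun s => ![f₀ s, f₁ s, f₂ s]) ![d₀, d₁, d₂] t := by
    rw [hasDerivAt_pi]
    intro i
    fin_cases i
    · exact h₀
    · exact h₁
    · exact h₂
  exact ((PiLp.continuousLinearEquiv 2 ℝ (fun _ : Fin 3 => ℝ)).symm :
    (Fin 3 → ℝ) →L[ℝ] E3).hasFDerivAt.comp_hasDerivAt t h

/-- The evolving surface of revolution with the profile `(h, ρ)`. -/
noncomputable def revolve (h ρ : ℝ → ℝ → ℝ) (p : ℝ × ℝ) (t : ℝ) : E3 :=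
  !₂[h p.1 t, ρ p.1 t * Real.cos p.2, ρ p.1 t * Real.sin p.2]

theorem hasDerivAt_revolve {h ρ : ℝ → ℝ → ℝ} {q : ℝ × ℝ} {t h' ρ' : ℝ}
    (hh : HasDerivAt (h q.1) h' t) (hρ : HasDerivAt (ρ q.1) ρ' t) :
    HasDerivAt (revolve h ρ q) !₂[h', ρ' * Real.cos q.2, ρ' * Real.sin q.2] t :=
  hasDerivAt_vec3 hh (hρ.mul_const _) (hρ.mul_const _)

/-- At a fixed angle only the profile moves, so the velocity is axially symmetric: its axial part is
the rate of `h`, and its radial part is `ρ' = c ρ`. -/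
theorem axialField_revolve {h ρ : ℝ → ℝ → ℝ} {q : ℝ × ℝ} {t h' ρ' : ℝ} {g c : ℝ → ℝ}
    (hh : HasDerivAt (h q.1) h' t) (hρ : HasDerivAt (ρ q.1) ρ' t) (hg : g (h q.1 t) = h')
    (hc : c (h q.1 t) * ρ q.1 t = ρ') :
    axialField g c (revolve h ρ q t) = deriv (revolve h ρ q) t := by
  rw [(hasDerivAt_revolve hh hρ).deriv, axialField, ← hg, ← hc]
  simp [revolve, mul_assoc]

theorem polar_injective {a b θ η : ℝ} (ha : 0 < a) (hb : 0 < b)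
    (hc : a * Real.cos θ = b * Real.cos η) (hs : a * Real.sin θ = b * Real.sin η)
    (hθ : θ ∈ Ico 0 (2 * Real.pi)) (hη : η ∈ Ico 0 (2 * Real.pi)) : a = b ∧ θ = η := by
  have hab : a = b := by
    have h2 : a ^ 2 = b ^ 2 := by
      calc a ^ 2 = (a * Real.cos θ) ^ 2 + (a * Real.sin θ) ^ 2 := by
            linear_combination -a ^ 2 * Real.sin_sq_add_cos_sq θ
        _ = (b * Real.cos η) ^ 2 + (b * Real.sin η) ^ 2 := by rw [hc, hs]
        _ = b ^ 2 := by linear_combination b ^ 2 * Real.sin_sq_add_cos_sq η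
    exact (pow_left_inj₀ ha.le hb.le two_ne_zero).1 h2
  subst hab
  refine ⟨rfl, ?_⟩
  have hang := Real.Angle.cos_sin_inj (mul_left_cancel₀ ha.ne' hc) (mul_left_cancel₀ ha.ne' hs)
  obtain ⟨k, hk⟩ := Real.Angle.angle_eq_iff_two_pi_dvd_sub.1 hang
  have hpi := Real.pi_pos
  have h1 : (k : ℝ) < 1 := by
    by_contra hcon
    push Not at hcon
    nlinarith [hθ.1, hθ.2, hη.1, hη.2]
  have h2 : (-1 : ℝ) < k := by
    by_contra hcon
    push Not at hcon
    nlinarith [hθ.1, hθ.2, hη.1, hη.2]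
  have hk0 : k = 0 := by
    have h1' : k < 1 := by exact_mod_cast h1
    have h2' : -1 < k := by exact_mod_cast h2
    omega
  rw [hk0] at hk
  simp only [Int.cast_zero, mul_zero] at hk
  linarith

section Revolve

variable {h ρ : ℝ → ℝ → ℝ} {s : ℝ} {q : ℝ × ℝ} {h' ρ' : ℝ}

theorem contDiffAt_revolve
    (hh : ContDiffAt ℝ 1 (fun z : ℝ × ℝ => h z.1 z.2) (q.1, s))
    (hρ : ContDiffAt ℝ 1 (fun z : ℝ × ℝ => ρ z.1 z.2) (q.1, s)) :
    ContDiffAt ℝ 1 (fun z : (ℝ × ℝ) × ℝ => revolve h ρ z.1 z.2) (q, s) := by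
  have hproj : ContDiffAt ℝ 1 (fun z : (ℝ × ℝ) × ℝ => (z.1.1, z.2)) (q, s) := by fun_prop
  have hh' : ContDiffAt ℝ 1 (fun z : (ℝ × ℝ) × ℝ => h z.1.1 z.2) (q, s) :=
    ContDiffAt.comp (g := fun z : ℝ × ℝ => h z.1 z.2)
      (f := fun z : (ℝ × ℝ) × ℝ => (z.1.1, z.2)) (q, s) hh hproj
  have hρ' : ContDiffAt ℝ 1 (fun z : (ℝ × ℝ) × ℝ => ρ z.1.1 z.2) (q, s) :=
    ContDiffAt.comp (g := fun z : ℝ × ℝ => ρ z.1 z.2)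
      (f := fun z : (ℝ × ℝ) × ℝ => (z.1.1, z.2)) (q, s) hρ hproj
  have hcos : ContDiffAt ℝ 1 (fun z : (ℝ × ℝ) × ℝ => Real.cos z.1.2) (q, s) := by fun_prop
  have hsin : ContDiffAt ℝ 1 (fun z : (ℝ × ℝ) × ℝ => Real.sin z.1.2) (q, s) := by fun_prop
  rw [contDiffAt_euclidean]
  intro i
  fin_cases i
  · exact hh'
  · exact hρ'.mul hcos
  · exact hρ'.mul hsin

theorem fderiv_revolve_apply (hd : DifferentiableAt ℝ (fun q => revolve h ρ q s) q)
    (hh : HasDerivAt (fun r => h r s) h' q.1) (hρ : HasDerivAt (fun r => ρ r s) ρ' q.1) :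
    fderiv ℝ (fun q => revolve h ρ q s) q (1, 0) =
      !₂[h', ρ' * Real.cos q.2, ρ' * Real.sin q.2] ∧
    fderiv ℝ (fun q => revolve h ρ q s) q (0, 1) =
      !₂[0, -(ρ q.1 s * Real.sin q.2), ρ q.1 s * Real.cos q.2] := by
  constructor
  · have h1 : HasDerivAt (fun r => revolve h ρ (r, q.2) s)
        (fderiv ℝ (fun q => revolve h ρ q s) q (1, 0)) q.1 :=
      HasFDerivAt.comp_hasDerivAt (f := fun r => (r, q.2)) q.1 hd.hasFDerivAt
        ((hasDerivAt_id q.1).prodMk (hasDerivAt_const q.1 q.2))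
    exact h1.unique (hasDerivAt_vec3 hh (hρ.mul_const (Real.cos q.2))
      (hρ.mul_const (Real.sin q.2)))
  · have h1 : HasDerivAt (fun θ => revolve h ρ (q.1, θ) s)
        (fderiv ℝ (fun q => revolve h ρ q s) q (0, 1)) q.2 :=
      HasFDerivAt.comp_hasDerivAt (f := fun θ => (q.1, θ)) q.2 hd.hasFDerivAt
        ((hasDerivAt_const q.2 q.1).prodMk (hasDerivAt_id q.2))
    refine h1.unique ?_
    have h2 := hasDerivAt_vec3 (hasDerivAt_const q.2 (h q.1 s))
      ((Real.hasDerivAt_cos q.2).const_mul (ρ q.1 s))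
      ((Real.hasDerivAt_sin q.2).const_mul (ρ q.1 s))
    rw [mul_neg] at h2
    exact h2

/-- A surface of revolution defines a flow chart if its area density has product form. -/
theorem isFlowChart_revolve {I : Set ℝ} {j : ℝ → ℝ} {u : ℝ × ℝ → ℝ}
    (hh : ∀ r ∈ Icc (0 : ℝ) 1, ∀ s ∈ I, ContDiffAt ℝ 1 (fun z : ℝ × ℝ => h z.1 z.2) (r, s))
    (hρ : ∀ r ∈ Icc (0 : ℝ) 1, ∀ s ∈ I, ContDiffAt ℝ 1 (fun z : ℝ × ℝ => ρ z.1 z.2) (r, s))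
    (hpos : ∀ r ∈ Ioo (0 : ℝ) 1, ∀ s ∈ I, 0 < ρ r s)
    (hinj : ∀ s ∈ I, ∀ r₁ ∈ Ioo (0 : ℝ) 1, ∀ r₂ ∈ Ioo (0 : ℝ) 1,
      h r₁ s = h r₂ s → ρ r₁ s = ρ r₂ s → r₁ = r₂)
    (harea : ∀ s ∈ I, ∀ q ∈ openDomain, ∃ h' ρ', HasDerivAt (fun r => h r s) h' q.1 ∧
      HasDerivAt (fun r => ρ r s) ρ' q.1 ∧ (h' ^ 2 + ρ' ^ 2) * ρ q.1 s ^ 2 = (j s * u q) ^ 2)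
    (hj : ContDiffOn ℝ 1 j I) (hj0 : ∀ s ∈ I, 0 < j s) (hu : ContinuousOn u closedDomain)
    (hu0 : ∀ q ∈ closedDomain, 0 ≤ u q) (hu1 : ∀ q ∈ openDomain, 0 < u q) :
    IsFlowChart I (revolve h ρ) j u := by
  have hsmooth : ∀ q ∈ closedDomain, ∀ s ∈ I,
      ContDiffAt ℝ 1 (fun z : (ℝ × ℝ) × ℝ => revolve h ρ z.1 z.2) (q, s) := fun q hq s hs =>
    contDiffAt_revolve (hh q.1 hq.1 s hs) (hρ q.1 hq.1 s hs)
  have hdiff : ∀ q ∈ openDomain, ∀ s ∈ I, DifferentiableAt ℝ (fun q => revolve h ρ q s) q := by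
    intro q hq s hs
    have h1 : ContDiffAt ℝ 1 (fun q => revolve h ρ q s) q :=
      ContDiffAt.comp (f := fun q : ℝ × ℝ => (q, s)) q
        (hsmooth q (openDomain_subset_closedDomain hq) s hs)
        (contDiffAt_id.prodMk contDiffAt_const)
    exact h1.differentiableAt one_ne_zero
  refine ⟨hsmooth, ?_, ?_, ?_, hj, hj0, hu, hu0, hu1⟩
  · intro s hs q hq p hp hqp
    have h0 := congrArg (fun x : E3 => x 0) hqp
    have h1 := congrArg (fun x : E3 => x 1) hqp
    have h2 := congrArg (fun x : E3 => x 2) hqp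
    simp only [revolve] at h0 h1 h2
    obtain ⟨e1, e2⟩ := polar_injective (hpos q.1 hq.1 s hs) (hpos p.1 hp.1 s hs) h1 h2
      (Ioo_subset_Ico_self hq.2) (Ioo_subset_Ico_self hp.2)
    exact Prod.ext (hinj s hs _ hq.1 _ hp.1 h0 e1) e2
  · intro s hs q hq
    obtain ⟨h', ρ', hh', hρ', -⟩ := harea s hs q hq
    obtain ⟨e1, e2⟩ := fderiv_revolve_apply (hdiff q hq s hs) hh' hρ'
    rw [e1, e2, inner_eq_sum_three]
    simp
    ring
  · intro s hs q hq
    obtain ⟨h', ρ', hh', hρ', ha⟩ := harea s hs q hq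
    obtain ⟨e1, e2⟩ := fderiv_revolve_apply (hdiff q hq s hs) hh' hρ'
    rw [e1, e2]
    refine (pow_left_inj₀ (by positivity) (mul_pos (hj0 s hs) (hu1 q hq)).le two_ne_zero).1 ?_
    rw [mul_pow, norm_sq_eq_sum_three, norm_sq_eq_sum_three, ← ha]
    have h3 := Real.sin_sq_add_cos_sq q.2
    have h4 : ((!₂[h', ρ' * Real.cos q.2, ρ' * Real.sin q.2] : E3) 0 ^ 2 +
        (!₂[h', ρ' * Real.cos q.2, ρ' * Real.sin q.2] : E3) 1 ^ 2 +
        (!₂[h', ρ' * Real.cos q.2, ρ' * Real.sin q.2] : E3) 2 ^ 2) = h' ^ 2 + ρ' ^ 2 := by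
      simp
      linear_combination ρ' ^ 2 * h3
    rw [h4]
    congr 1
    simp
    linear_combination ρ q.1 s ^ 2 * h3

/-- The surface divergence of a field that coincides with an axially symmetric field on a surface
of revolution. -/
theorem surfDiv_revolve {Γ : Set E3} {n : E3 → E3} {w : E3 → E3} {g c : ℝ → ℝ}
    {g' c' n₀ n₁ : ℝ}
    (hd : DifferentiableAt ℝ (fun q => revolve h ρ q s) q)
    (hh : HasDerivAt (fun r => h r s) h' q.1) (hρ : HasDerivAt (fun r => ρ r s) ρ' q.1)
    (hreg : h' ^ 2 + ρ' ^ 2 ≠ 0) (hpos : 0 < ρ q.1 s)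
    (hmem : ∀ᶠ p in 𝓝 q, revolve h ρ p s ∈ Γ)
    (hw : w =ᶠ[𝓝[Γ] (revolve h ρ q s)] axialField g c)
    (hg : HasDerivAt g g' (h q.1 s)) (hc : HasDerivAt c c' (h q.1 s))
    (hn : n (revolve h ρ q s) = !₂[n₀, n₁ * Real.cos q.2, n₁ * Real.sin q.2])
    (hn1 : n₀ ^ 2 + n₁ ^ 2 = 1) (hnh : n₀ * h' + n₁ * ρ' = 0) :
    DifferentiableWithinAt ℝ w Γ (revolve h ρ q s) ∧
    surfDiv Γ n w (revolve h ρ q s) =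
      g' * (1 - n₀ ^ 2) + c (h q.1 s) * (1 + n₀ ^ 2) - c' * n₀ * n₁ * ρ q.1 s := by
  obtain ⟨G, hG, hGv⟩ := exists_hasFDerivAt_axialField (x := revolve h ρ q s) hg hc
  obtain ⟨e1, e2⟩ := fderiv_revolve_apply hd hh hρ
  have h3 := Real.sin_sq_add_cos_sq q.2
  have hX2 : ‖(!₂[h', ρ' * Real.cos q.2, ρ' * Real.sin q.2] : E3)‖ ^ 2 = h' ^ 2 + ρ' ^ 2 := by
    rw [norm_sq_eq_sum_three]
    simp
    linear_combination ρ' ^ 2 * h3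
  have hY2 : ‖(!₂[0, -(ρ q.1 s * Real.sin q.2), ρ q.1 s * Real.cos q.2] : E3)‖ ^ 2 =
      ρ q.1 s ^ 2 := by
    rw [norm_sq_eq_sum_three]
    simp
    linear_combination ρ q.1 s ^ 2 * h3
  obtain ⟨r1, r2⟩ := surfDiv_eq_of_eventuallyEq (n := n) hd.hasFDerivAt hmem hw hG
    (by
      rw [hn]
      refine (pow_left_inj₀ (norm_nonneg _) zero_le_one two_ne_zero).1 ?_
      rw [norm_sq_eq_sum_three, one_pow, ← hn1]
      simp
      linear_combination n₁ ^ 2 * h3)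
    (by
      rw [e1]
      intro h0
      rw [h0] at hX2
      simp at hX2
      exact hreg hX2.symm)
    (by
      rw [e2]
      intro h0
      rw [h0] at hY2
      simp at hY2
      exact (pow_pos hpos 2).ne hY2)
    (by
      rw [hn, e1, inner_eq_sum_three]
      simp
      linear_combination hnh + n₁ * ρ' * h3)
    (by
      rw [hn, e2, inner_eq_sum_three]
      simp
      ring)
    (by
      rw [e1, e2, inner_eq_sum_three]
      simp
      ring)
  refine ⟨r1, ?_⟩
  rw [r2]
  -- The sum is `tr G - ⟨n, G n⟩`, with `tr G = g' + 2 c` and `⟨n, G n⟩ = g' n₀² + c n₁² + c' n₀ n₁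
  -- ρ`; finally `2 - n₁² = 1 + n₀²`.
  simp only [Fin.sum_univ_three, hGv, hn]
  simp [revolve]
  linear_combination (-(n₁ ^ 2 * c (h q.1 s)) - c' * n₀ * n₁ * ρ q.1 s) * h3 -
    c (h q.1 s) * hn1

end Revolve

/-! ### Transport within one chart and gluing of two charts -/

section Portions

variable {I : Set ℝ} {φ : ℝ × ℝ → ℝ → E3} {j : ℝ → ℝ} {u : ℝ × ℝ → ℝ}

/-- Reduces statements almost everywhere on a portion to interior parameters, since the edge of the
rectangle has null image. -/
theorem IsFlowChart.ae_restrict_image (h : IsFlowChart I φ j u) {s : ℝ} (hs : s ∈ I)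
    {U : Set (ℝ × ℝ)} (hU : NullMeasurableSet U) (hUK : U ⊆ closedDomain) {P : E3 → Prop}
    (hP : ∀ q ∈ U ∩ openDomain, P (φ q s)) :
    ∀ᵐ x ∂(μHE[2] : Measure E3).restrict ((fun q => φ q s) '' U), P x := by
  have h0 : μHE[2] ((fun q => φ q s) '' (closedDomain \ openDomain)) = 0 :=
    h.measure_image_eq_zero hs sdiff_subset volume_closedDomain_diff_openDomain
  filter_upwards [ae_restrict_mem₀ (h.nullMeasurableSet_image hs hU hUK),
    ae_restrict_of_ae (measure_eq_zero_iff_ae_notMem.1 h0)] with x hx hx0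
  obtain ⟨q, hq, rfl⟩ := hx
  by_cases hqo : q ∈ openDomain
  · exact hP q ⟨hq, hqo⟩
  · exact absurd ⟨q, ⟨hUK hq, hqo⟩, rfl⟩ hx0

/-- The transport theorem for a portion inside one chart, for a velocity field `w` that coincides
there with a measurable field `W` and has the surface divergence `j' / j`. -/
theorem IsFlowChart.transport_surfDiv (hI : IsOpen I) (h : IsFlowChart I φ j u) {t : ℝ}
    (ht : t ∈ I) {Γ : Set E3} {n : E3 → E3} {w W : E3 → ℝ → E3}
    (hW : ∀ q ∈ closedDomain, W (φ q t) t = deriv (φ q) t) (hWm : Measurable fun x => W x t)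
    {U : Set (ℝ × ℝ)} (hU : NullMeasurableSet U) (hUK : U ⊆ closedDomain)
    (hwW : ∀ q ∈ U, w (φ q t) t = W (φ q t) t)
    (hdiv : ∀ q ∈ openDomain, surfDiv Γ n (fun y => w y t) (φ q t) = deriv j t / j t)
    {f : E3 → ℝ → ℝ} (hf : ContDiff ℝ 1 (fun q : E3 × ℝ => f q.1 q.2)) :
    IntegrableOn (fun x => f x t) ((fun q => φ q t) '' U) μHE[2] ∧
    IntegrableOn (fun x => materialDeriv w f x t + surfDiv Γ n (fun y => w y t) x * f x t)
      ((fun q => φ q t) '' U) μHE[2] ∧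
    HasDerivAt (fun s => ∫ x in (fun q => φ q s) '' U, f x s ∂μHE[2])
      (∫ x in (fun q => φ q t) '' U,
        (materialDeriv w f x t + surfDiv Γ n (fun y => w y t) x * f x t) ∂μHE[2]) t := by
  obtain ⟨h1, h2, h3⟩ := h.transport hI ht hW hWm hU hUK hf
  -- The field `w` may be defined by choice of parameters, so measurability is taken from `W`. The
  -- material derivative involves only the values of the field, so agreement on the portion is
  -- enough for it.
  have hcongr : (fun x => materialDeriv W f x t + deriv j t / j t * f x t)
      =ᵐ[(μHE[2] : Measure E3).restrict ((fun q => φ q t) '' U)]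
      fun x => materialDeriv w f x t + surfDiv Γ n (fun y => w y t) x * f x t := by
    refine h.ae_restrict_image ht hU hUK fun q hq => ?_
    dsimp only
    rw [hdiv q hq.2, materialDeriv, materialDeriv, hwW q hq.1]
  refine ⟨h1, h2.congr hcongr, ?_⟩
  rw [← integral_congr_ae hcongr]
  exact h3

end Portions

/-- Combination of two disjoint moving portions. -/
theorem hasDerivAt_setIntegral_union {I : Set ℝ} (hI : IsOpen I) {t : ℝ} (ht : t ∈ I)
    {A B Ω : ℝ → Set E3} {f : E3 → ℝ → ℝ} {g : E3 → ℝ}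
    (hΩ : ∀ s ∈ I, Ω s = A s ∪ B s) (hdisj : ∀ s ∈ I, Disjoint (A s) (B s))
    (hBm : ∀ s ∈ I, NullMeasurableSet (B s) μHE[2])
    (hA : ∀ s ∈ I, IntegrableOn (fun x => f x s) (A s) μHE[2])
    (hB : ∀ s ∈ I, IntegrableOn (fun x => f x s) (B s) μHE[2])
    (hgA : IntegrableOn g (A t) μHE[2]) (hgB : IntegrableOn g (B t) μHE[2])
    (hdA : HasDerivAt (fun s => ∫ x in A s, f x s ∂μHE[2]) (∫ x in A t, g x ∂μHE[2]) t)
    (hdB : HasDerivAt (fun s => ∫ x in B s, f x s ∂μHE[2]) (∫ x in B t, g x ∂μHE[2]) t) :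
    IntegrableOn (fun x => f x t) (Ω t) μHE[2] ∧ IntegrableOn g (Ω t) μHE[2] ∧
    HasDerivAt (fun s => ∫ x in Ω s, f x s ∂μHE[2]) (∫ x in Ω t, g x ∂μHE[2]) t := by
  refine ⟨?_, ?_, ?_⟩
  · rw [hΩ t ht]; exact (hA t ht).union (hB t ht)
  · rw [hΩ t ht]; exact hgA.union hgB
  · rw [hΩ t ht, setIntegral_union₀ (hdisj t ht).aedisjoint (hBm t ht) hgA hgB]
    refine (hdA.add hdB).congr_of_eventuallyEq ?_
    filter_upwards [hI.mem_nhds ht] with s hs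
    rw [hΩ s hs, setIntegral_union₀ (hdisj s hs).aedisjoint (hBm s hs) (hA s hs) (hB s hs)]
    rfl

/-! ### The velocity defined by two charts -/

/-- Well-definedness: the time derivative is a function `W` of the point alone, so the choice of
parameter is immaterial, also at the pole and on the meridian where the chart is not injective. -/
theorem twoChartVelocity_eq_of_mem {φ ψ : ℝ × ℝ → ℝ → E3} {U V : Set (ℝ × ℝ)} {t : ℝ}
    {W : E3 → E3} (hW : ∀ p ∈ U, W (φ p t) = deriv (φ p) t) {p : ℝ × ℝ} (hp : p ∈ U) :
    twoChartVelocity φ U ψ V (φ p t) t = W (φ p t) := by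
  have h : ∃ p' ∈ U, φ p t = φ p' t := ⟨p, hp, rfl⟩
  rw [twoChartVelocity, dif_pos h]
  have hs := h.choose_spec
  exact (hW _ hs.1).symm.trans (congrArg W hs.2.symm)

theorem twoChartVelocity_eq_of_mem_right {φ ψ : ℝ × ℝ → ℝ → E3} {U V : Set (ℝ × ℝ)} {t : ℝ}
    {W : E3 → E3} (hW : ∀ q ∈ V, W (ψ q t) = deriv (ψ q) t)
    (hdisj : ∀ p ∈ U, ∀ q ∈ V, ψ q t ≠ φ p t) {q : ℝ × ℝ} (hq : q ∈ V) :
    twoChartVelocity φ U ψ V (ψ q t) t = W (ψ q t) := by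
  have h : ¬ ∃ p' ∈ U, ψ q t = φ p' t := fun ⟨p, hp, he⟩ => hdisj p hp q hq he
  have h' : ∃ q' ∈ V, ψ q t = ψ q' t := ⟨q, hq, rfl⟩
  rw [twoChartVelocity, dif_neg h, dif_pos h']
  have hs := h'.choose_spec
  exact (hW _ hs.1).symm.trans (congrArg W hs.2.symm)

/-! ### Regularity of the data in time -/

theorem hasDerivAt_of_contDiffOn (hI : IsOpen I) {κ : ℝ → ℝ} (hκ : ContDiffOn ℝ 1 κ I) {s : ℝ}
    (hs : s ∈ I) : HasDerivAt κ (deriv κ s) s :=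
  ((hκ.contDiffAt (hI.mem_nhds hs)).differentiableAt one_ne_zero).hasDerivAt

theorem contDiffAt_snd_comp (hI : IsOpen I) {κ : ℝ → ℝ} (hκ : ContDiffOn ℝ 1 κ I) (r : ℝ) {s : ℝ}
    (hs : s ∈ I) : ContDiffAt ℝ 1 (fun z : ℝ × ℝ => κ z.2) (r, s) :=
  ContDiffAt.comp (f := fun z : ℝ × ℝ => z.2) (r, s) (hκ.contDiffAt (hI.mem_nhds hs))
    contDiffAt_snd

/-! ### The separating disc -/

section Disc

variable {I : Set ℝ} {ν ρ : ℝ → ℝ}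

theorem isFlowChart_disc (hI : IsOpen I) (hν : ContDiffOn ℝ 1 ν I) (hρ : ContDiffOn ℝ 1 ρ I)
    (hρ0 : ∀ s ∈ I, 0 < ρ s) :
    IsFlowChart I (revolve (fun _ s => ν s) (fun r s => ρ s * r)) (fun s => ρ s ^ 2)
      (fun q => q.1) := by
  refine isFlowChart_revolve (fun r _ s hs => contDiffAt_snd_comp hI hν r hs)
    (fun r _ s hs => (contDiffAt_snd_comp hI hρ r hs).mul contDiffAt_fst)
    (fun r hr s hs => mul_pos (hρ0 s hs) hr.1) ?_ ?_ (hρ.pow 2)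
    (fun s hs => pow_pos (hρ0 s hs) 2) continuousOn_fst (fun q hq => hq.1.1)
    (fun q hq => hq.1.1)
  · intro s hs r₁ _ r₂ _ _ h
    exact mul_left_cancel₀ (hρ0 s hs).ne' h
  · intro s hs q hq
    refine ⟨0, ρ s, hasDerivAt_const _ _, ?_, by ring⟩
    simpa using (hasDerivAt_id q.1).const_mul (ρ s)

end Disc

/-! ### Spherical pieces

The two spherical pieces of the double bubble are treated together: `σ = ±1`, the center is
`-σ m`, the radius is `R`, and `k - m - R / 2` is the bound for the first coordinate, up to the
sign `σ`. -/

/-- The axial coordinate of the chart around the pole. -/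
noncomputable def capHeight (σ : ℝ) (m R : ℝ → ℝ) (r t : ℝ) : ℝ :=
  σ * (-√(R t ^ 2 - 3 * R t ^ 2 * r ^ 2 / 4) - m t)

/-- The distance from the axis in the chart around the pole. -/
noncomputable def capRadius (R : ℝ → ℝ) (r t : ℝ) : ℝ := √3 / 2 * R t * r

/-- The axial coordinate, relative to the center of the sphere, in the chart of the zone. -/
noncomputable def zoneDepth (R k : ℝ → ℝ) (r t : ℝ) : ℝ := k t * r - R t / 2

/-- The axial coordinate of the chart of the zone. -/
noncomputable def zoneHeight (σ : ℝ) (m R k : ℝ → ℝ) (r t : ℝ) : ℝ :=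
  σ * (zoneDepth R k r t - m t)

/-- The distance from the axis in the chart of the zone. -/
noncomputable def zoneRadius (R k : ℝ → ℝ) (r t : ℝ) : ℝ := √(R t ^ 2 - zoneDepth R k r t ^ 2)

/-- The velocity of the cap, as a field on space. -/
noncomputable def capField (σ : ℝ) (m R : ℝ → ℝ) (x : E3) (t : ℝ) : E3 :=
  axialField (fun ξ => deriv R t / R t * (ξ + σ * m t) - σ * deriv m t)
    (fun _ => deriv R t / R t) x

/-- The time derivative of `zoneDepth`, as a function of the depth. -/
noncomputable def zoneRate (R k : ℝ → ℝ) (t y : ℝ) : ℝ :=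
  deriv k t / k t * (y + R t / 2) - deriv R t / 2

/-- The velocity of the zone, as a field on space. -/
noncomputable def zoneField (σ : ℝ) (m R k : ℝ → ℝ) (x : E3) (t : ℝ) : E3 :=
  axialField (fun ξ => σ * (zoneRate R k t (σ * ξ + m t) - deriv m t))
    (fun ξ => (R t * deriv R t - (σ * ξ + m t) * zoneRate R k t (σ * ξ + m t)) /
      (R t ^ 2 - (σ * ξ + m t) ^ 2)) x

theorem measurable_capField (σ : ℝ) (m R : ℝ → ℝ) (t : ℝ) :
    Measurable fun x => capField σ m R x t :=
  measurable_axialField (by fun_prop) (by fun_prop)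

theorem measurable_zoneField (σ : ℝ) (m R k : ℝ → ℝ) (t : ℝ) :
    Measurable fun x => zoneField σ m R k x t :=
  measurable_axialField (by unfold zoneRate; fun_prop) (by unfold zoneRate; fun_prop)

/-- The assumptions on the data of a spherical piece. -/
structure IsSphericalData (I : Set ℝ) (σ : ℝ) (m R k : ℝ → ℝ) : Prop where
  isOpen : IsOpen I
  sign : σ ^ 2 = 1
  m_smooth : ContDiffOn ℝ 1 m I
  R_smooth : ContDiffOn ℝ 1 R I
  k_smooth : ContDiffOn ℝ 1 k I
  R_pos : ∀ s ∈ I, 0 < R s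
  k_pos : ∀ s ∈ I, 0 < k s
  k_lt : ∀ s ∈ I, k s < 3 / 2 * R s

namespace IsSphericalData

variable {I : Set ℝ} {σ : ℝ} {m R k : ℝ → ℝ}

theorem one_sub_pos {r : ℝ} (hr : r ∈ Icc (0 : ℝ) 1) : 0 < 1 - 3 * r ^ 2 / 4 := by
  nlinarith [hr.1, hr.2]

theorem cap_radicand {r s : ℝ} : R s ^ 2 - 3 * R s ^ 2 * r ^ 2 / 4 =
    R s ^ 2 * (1 - 3 * r ^ 2 / 4) := by ring

/-- With `R` pulled out of the root, the chart at fixed parameters is a fixed unit vector scaled by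
`R` and translated with the center. -/
theorem capHeight_eq (h : IsSphericalData I σ m R k) {s : ℝ} (hs : s ∈ I) (r : ℝ) :
    capHeight σ m R r s = σ * (-(R s * √(1 - 3 * r ^ 2 / 4)) - m s) := by
  rw [capHeight, cap_radicand, Real.sqrt_mul (sq_nonneg _), Real.sqrt_sq (h.R_pos s hs).le]

theorem hasDerivAt_sqrt_one_sub {r : ℝ} (hr : r ∈ Icc (0 : ℝ) 1) :
    HasDerivAt (fun r => √(1 - 3 * r ^ 2 / 4)) (-(3 * r / 4) / √(1 - 3 * r ^ 2 / 4)) r := by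
  have h1 : HasDerivAt (fun r : ℝ => 1 - 3 * r ^ 2 / 4) (-(3 * r / 2)) r := by
    refine ((((hasDerivAt_pow 2 r).const_mul 3).div_const 4).const_sub 1).congr_deriv ?_
    norm_num
    ring
  convert h1.sqrt (one_sub_pos hr).ne' using 1
  have := (Real.sqrt_pos.2 (one_sub_pos hr)).ne'
  field_simp
  ring

theorem hasDerivAt_capHeight (h : IsSphericalData I σ m R k) {s : ℝ} (hs : s ∈ I) {r : ℝ}
    (hr : r ∈ Icc (0 : ℝ) 1) :
    HasDerivAt (fun r => capHeight σ m R r s)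
      (σ * (R s * (3 * r / 4) / √(1 - 3 * r ^ 2 / 4))) r := by
  have h1 := (((((hasDerivAt_sqrt_one_sub hr).const_mul (R s)).neg).sub_const (m s)).const_mul σ)
  rw [show (fun r => capHeight σ m R r s) =
    fun r => σ * (-(R s * √(1 - 3 * r ^ 2 / 4)) - m s) from funext fun r => h.capHeight_eq hs r]
  exact h1.congr_deriv (by ring)

theorem hasDerivAt_capRadius {s r : ℝ} :
    HasDerivAt (fun r => capRadius R r s) (√3 / 2 * R s) r := by
  simpa [capRadius] using (hasDerivAt_id r).const_mul (√3 / 2 * R s)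

/-- Caps at different times are homothetic with the same parameters, so time enters the area density
only through `R²`. -/
theorem isFlowChart_cap (h : IsSphericalData I σ m R k) :
    IsFlowChart I (revolve (capHeight σ m R) (capRadius R)) (fun s => R s ^ 2)
      (fun q => 3 * q.1 / 4 / √(1 - 3 * q.1 ^ 2 / 4)) := by
  have h3 : (√3) ^ 2 = 3 := Real.sq_sqrt (by norm_num)
  refine isFlowChart_revolve ?_ ?_ ?_ ?_ ?_ (h.R_smooth.pow 2)
    (fun s hs => pow_pos (h.R_pos s hs) 2) ?_ ?_ ?_
  · intro r hr s hs
    have hR := contDiffAt_snd_comp h.isOpen h.R_smooth r hs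
    have hm := contDiffAt_snd_comp h.isOpen h.m_smooth r hs
    unfold capHeight
    refine contDiffAt_const.mul (((ContDiffAt.sqrt ?_ ?_).neg).sub hm)
    · exact (hR.pow 2).sub (((contDiffAt_const.mul (hR.pow 2)).mul
        (contDiffAt_fst.pow 2)).div_const 4)
    · change R s ^ 2 - 3 * R s ^ 2 * r ^ 2 / 4 ≠ 0
      rw [cap_radicand]
      exact (mul_pos (pow_pos (h.R_pos s hs) 2) (one_sub_pos hr)).ne'
  · intro r hr s hs
    have hR := contDiffAt_snd_comp h.isOpen h.R_smooth r hs
    exact (contDiffAt_const.mul hR).mul contDiffAt_fst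
  · intro r hr s hs
    have := h.R_pos s hs
    have := hr.1
    unfold capRadius
    positivity
  · intro s hs r₁ _ r₂ _ _ he
    have := h.R_pos s hs
    exact mul_left_cancel₀ (by positivity) he
  · intro s hs q hq
    have hr : q.1 ∈ Icc (0 : ℝ) 1 := Ioo_subset_Icc_self hq.1
    refine ⟨_, _, h.hasDerivAt_capHeight hs hr, hasDerivAt_capRadius, ?_⟩
    have hp := one_sub_pos hr
    have h0 := (Real.sqrt_pos.2 hp).ne'
    have h2 := Real.sq_sqrt hp.le
    set κ := √(1 - 3 * q.1 ^ 2 / 4)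
    have e : (σ * (R s * (3 * q.1 / 4) / κ)) ^ 2 + (√3 / 2 * R s) ^ 2 =
        3 / 4 * R s ^ 2 / κ ^ 2 := by
      have : (σ * (R s * (3 * q.1 / 4) / κ)) ^ 2 = R s ^ 2 * (9 * q.1 ^ 2 / 16) / κ ^ 2 := by
        rw [mul_pow, h.sign]; ring
      rw [this, mul_pow, div_pow, h3]
      field_simp
      linear_combination 192 * R s ^ 2 * h2
    rw [e, capRadius]
    field_simp
    linear_combination 4 * R s ^ 4 * q.1 ^ 2 * h3
  · refine ContinuousOn.div (by fun_prop) (by fun_prop) fun q hq => ?_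
    exact (Real.sqrt_pos.2 (one_sub_pos hq.1)).ne'
  · intro q hq
    have := hq.1.1
    positivity
  · intro q hq
    have := hq.1.1
    have := Real.sqrt_pos.2 (one_sub_pos (Ioo_subset_Icc_self hq.1))
    positivity

/-- The velocity of a homothety about a moving center: `R'/R` times the position relative to the
center, plus the velocity of the center `-σ m`. -/
theorem capField_eq_deriv (h : IsSphericalData I σ m R k) {t : ℝ} (ht : t ∈ I) {q : ℝ × ℝ} :
    capField σ m R (revolve (capHeight σ m R) (capRadius R) q t) t =
      deriv (revolve (capHeight σ m R) (capRadius R) q) t := by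
  have hR := hasDerivAt_of_contDiffOn h.isOpen h.R_smooth ht
  have hm := hasDerivAt_of_contDiffOn h.isOpen h.m_smooth ht
  have hR0 := (h.R_pos t ht).ne'
  have hh : HasDerivAt (capHeight σ m R q.1)
      (σ * (-(deriv R t * √(1 - 3 * q.1 ^ 2 / 4)) - deriv m t)) t := by
    refine (((hR.mul_const _).neg.sub hm).const_mul σ).congr_of_eventuallyEq ?_
    filter_upwards [h.isOpen.mem_nhds ht] with s hs using h.capHeight_eq hs q.1
  have hρ : HasDerivAt (capRadius R q.1) (√3 / 2 * deriv R t * q.1) t :=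
    (hR.const_mul (√3 / 2)).mul_const q.1
  refine axialField_revolve hh hρ ?_ ?_
  · rw [h.capHeight_eq ht]
    field_simp
    ring
  · rw [capRadius]
    field_simp

/-- The depth runs from `-R/2` to `k - R/2`, which lies below `R` by `k_lt`; the zone therefore
stays away from both poles and its radius is smooth. -/
theorem zoneDepth_mem (h : IsSphericalData I σ m R k) {s : ℝ} (hs : s ∈ I) {r : ℝ}
    (hr : r ∈ Icc (0 : ℝ) 1) :
    0 < R s ^ 2 - zoneDepth R k r s ^ 2 := by
  have h1 := h.R_pos s hs
  have h2 := h.k_pos s hs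
  have h3 := h.k_lt s hs
  have h4 : 0 ≤ k s * r := mul_nonneg h2.le hr.1
  have h5 : k s * r ≤ k s := by nlinarith [hr.2]
  have : R s ^ 2 - zoneDepth R k r s ^ 2 =
      (R s - zoneDepth R k r s) * (R s + zoneDepth R k r s) := by ring
  rw [this]
  apply mul_pos <;> unfold zoneDepth <;> linarith

theorem hasDerivAt_zoneDepth {s r : ℝ} : HasDerivAt (fun r => zoneDepth R k r s) (k s) r := by
  simpa [zoneDepth] using ((hasDerivAt_id r).const_mul (k s)).sub_const (R s / 2)

theorem hasDerivAt_zoneHeight {s r : ℝ} :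
    HasDerivAt (fun r => zoneHeight σ m R k r s) (σ * k s) r :=
  (hasDerivAt_zoneDepth.sub_const (m s)).const_mul σ

theorem hasDerivAt_zoneRadius (h : IsSphericalData I σ m R k) {s : ℝ} (hs : s ∈ I) {r : ℝ}
    (hr : r ∈ Icc (0 : ℝ) 1) :
    HasDerivAt (fun r => zoneRadius R k r s)
      (-(zoneDepth R k r s * k s) / zoneRadius R k r s) r := by
  have h1 : HasDerivAt (fun r => zoneRadius R k r s) _ r :=
    (((hasDerivAt_zoneDepth (R := R) (k := k) (s := s) (r := r)).pow 2).const_sub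
      (R s ^ 2)).sqrt (h.zoneDepth_mem hs hr).ne'
  convert h1 using 1
  have := (Real.sqrt_pos.2 (h.zoneDepth_mem hs hr)).ne'
  simp only [zoneRadius, Nat.cast_ofNat, Nat.add_one_sub_one, pow_one, Pi.pow_apply]
  field_simp

/-- Archimedes: the area element of a sphere is `R` times the height element times the angle
element. Height is linear in `r` with slope of size `k`, so the density is constant on the
rectangle. -/
theorem isFlowChart_zone (h : IsSphericalData I σ m R k) :
    IsFlowChart I (revolve (zoneHeight σ m R k) (zoneRadius R k)) (fun s => R s * k s)
      (fun _ => 1) := by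
  have hD : ∀ r ∈ Icc (0 : ℝ) 1, ∀ s ∈ I,
      ContDiffAt ℝ 1 (fun z : ℝ × ℝ => zoneDepth R k z.1 z.2) (r, s) := by
    intro r hr s hs
    have hR := contDiffAt_snd_comp h.isOpen h.R_smooth r hs
    have hk := contDiffAt_snd_comp h.isOpen h.k_smooth r hs
    exact (hk.mul contDiffAt_fst).sub (hR.div_const 2)
  refine isFlowChart_revolve ?_ ?_ ?_ ?_ ?_ (h.R_smooth.mul h.k_smooth)
    (fun s hs => mul_pos (h.R_pos s hs) (h.k_pos s hs)) continuousOn_const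
    (fun _ _ => zero_le_one) (fun _ _ => zero_lt_one)
  · intro r hr s hs
    have hm := contDiffAt_snd_comp h.isOpen h.m_smooth r hs
    exact contDiffAt_const.mul ((hD r hr s hs).sub hm)
  · intro r hr s hs
    have hR := contDiffAt_snd_comp h.isOpen h.R_smooth r hs
    exact ((hR.pow 2).sub ((hD r hr s hs).pow 2)).sqrt (h.zoneDepth_mem hs hr).ne'
  · intro r hr s hs
    exact Real.sqrt_pos.2 (h.zoneDepth_mem hs (Ioo_subset_Icc_self hr))
  · intro s hs r₁ _ r₂ _ he _
    have hσ : σ ≠ 0 := by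
      rintro rfl
      simpa using h.sign
    have h1 := mul_left_cancel₀ hσ he
    simp only [zoneDepth] at h1
    exact mul_left_cancel₀ (h.k_pos s hs).ne' (by linarith)
  · intro s hs q hq
    have hr : q.1 ∈ Icc (0 : ℝ) 1 := Ioo_subset_Icc_self hq.1
    refine ⟨_, _, hasDerivAt_zoneHeight, h.hasDerivAt_zoneRadius hs hr, ?_⟩
    have hp := h.zoneDepth_mem hs hr
    have h0 : zoneRadius R k q.1 s ≠ 0 := (Real.sqrt_pos.2 hp).ne'
    have h2 : zoneRadius R k q.1 s ^ 2 = R s ^ 2 - zoneDepth R k q.1 s ^ 2 := Real.sq_sqrt hp.le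
    rw [mul_pow, h.sign]
    field_simp
    rw [h2]
    ring

/-- Solving the depth for `r = (y + R/2) / k` expresses its rate by the depth alone. Differentiating
`ρ² = R² - y²` then gives the radial velocity; dividing it by `ρ` produces the denominator `R² -
y²`. -/
theorem zoneField_eq_deriv (h : IsSphericalData I σ m R k) {t : ℝ} (ht : t ∈ I) {q : ℝ × ℝ}
    (hr : q.1 ∈ Icc (0 : ℝ) 1) :
    zoneField σ m R k (revolve (zoneHeight σ m R k) (zoneRadius R k) q t) t =
      deriv (revolve (zoneHeight σ m R k) (zoneRadius R k) q) t := by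
  have hR := hasDerivAt_of_contDiffOn h.isOpen h.R_smooth ht
  have hm := hasDerivAt_of_contDiffOn h.isOpen h.m_smooth ht
  have hk := hasDerivAt_of_contDiffOn h.isOpen h.k_smooth ht
  have hk0 := (h.k_pos t ht).ne'
  have hp := h.zoneDepth_mem ht hr
  have hdepth : HasDerivAt (zoneDepth R k q.1) (zoneRate R k t (zoneDepth R k q.1 t)) t := by
    have h1 : HasDerivAt (zoneDepth R k q.1) (deriv k t * q.1 - deriv R t / 2) t :=
      (hk.mul_const q.1).sub (hR.div_const 2)
    convert h1 using 1
    rw [zoneRate, zoneDepth]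
    field_simp
    ring
  set y := zoneDepth R k q.1 t with hy
  have hσ : σ * (σ * (y - m t)) + m t = y := by
    linear_combination (y - m t) * h.sign
  have hh : HasDerivAt (zoneHeight σ m R k q.1) (σ * (zoneRate R k t y - deriv m t)) t :=
    (hdepth.sub hm).const_mul σ
  have hρ : HasDerivAt (zoneRadius R k q.1)
      ((R t * deriv R t - y * zoneRate R k t y) / zoneRadius R k q.1 t) t := by
    have h1 : HasDerivAt (zoneRadius R k q.1) _ t :=
      ((hR.pow 2).sub (hdepth.pow 2)).sqrt hp.ne'
    convert h1 using 1
    have := (Real.sqrt_pos.2 hp).ne'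
    simp only [zoneRadius, ← hy, Pi.pow_apply, Pi.sub_apply, Nat.cast_ofNat, Nat.add_one_sub_one,
      pow_one]
    field_simp
  refine axialField_revolve hh hρ ?_ ?_
  · simp only [zoneHeight, ← hy, hσ]
  · simp only [zoneHeight, ← hy, hσ]
    have h2 : zoneRadius R k q.1 t ^ 2 = R t ^ 2 - y ^ 2 := Real.sq_sqrt hp.le
    have h0 : zoneRadius R k q.1 t ≠ 0 := (Real.sqrt_pos.2 hp).ne'
    rw [← h2]
    field_simp

end IsSphericalData

theorem exists_polar {x y ρ : ℝ} (hρ : 0 ≤ ρ) (h : x ^ 2 + y ^ 2 = ρ ^ 2) :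
    ∃ θ ∈ Icc 0 (2 * Real.pi), x = ρ * Real.cos θ ∧ y = ρ * Real.sin θ := by
  have hpi := Real.pi_pos
  set z : ℂ := ⟨x, y⟩
  have hz : ‖z‖ = ρ := by
    refine (pow_left_inj₀ (norm_nonneg _) hρ two_ne_zero).1 ?_
    rw [← Complex.normSq_eq_norm_sq, Complex.normSq_mk, ← h]
    ring
  have hx : x = ρ * Real.cos z.arg := by rw [← hz, Complex.norm_mul_cos_arg]
  have hy : y = ρ * Real.sin z.arg := by rw [← hz, Complex.norm_mul_sin_arg]
  rcases le_or_gt 0 z.arg with h0 | h0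
  · exact ⟨z.arg, ⟨h0, by linarith [Complex.arg_le_pi z]⟩, hx, hy⟩
  · refine ⟨z.arg + 2 * Real.pi, ⟨by linarith [Complex.neg_pi_lt_arg z], by linarith⟩, ?_, ?_⟩
    · rw [Real.cos_add_two_pi]; exact hx
    · rw [Real.sin_add_two_pi]; exact hy

theorem exists_revolve_eq {h ρ : ℝ → ℝ → ℝ} {r t : ℝ} {x : E3} (hh : h r t = x 0)
    (hρ : 0 ≤ ρ r t) (hx : x 1 ^ 2 + x 2 ^ 2 = ρ r t ^ 2) :
    ∃ θ ∈ Icc 0 (2 * Real.pi), x = revolve h ρ (r, θ) t := by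
  obtain ⟨θ, hθ, h1, h2⟩ := exists_polar hρ hx
  refine ⟨θ, hθ, ?_⟩
  ext i
  fin_cases i
  · exact hh.symm
  · exact h1
  · exact h2

theorem revolve_sq {h ρ : ℝ → ℝ → ℝ} {q : ℝ × ℝ} {t : ℝ} :
    revolve h ρ q t 1 ^ 2 + revolve h ρ q t 2 ^ 2 = ρ q.1 t ^ 2 := by
  simp only [revolve]
  simp
  linear_combination ρ q.1 t ^ 2 * Real.sin_sq_add_cos_sq q.2

/-- The spherical piece. -/
def sphericalPiece (σ : ℝ) (m R k : ℝ → ℝ) (t : ℝ) : Set E3 :=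
  {x | (x 0 + σ * m t) ^ 2 + x 1 ^ 2 + x 2 ^ 2 = R t ^ 2 ∧ σ * x 0 < k t - m t - R t / 2}

/-- The outer unit normal of the spherical piece. -/
noncomputable def sphericalNormal (σ : ℝ) (m R : ℝ → ℝ) (t : ℝ) (x : E3) : E3 :=
  (R t)⁻¹ • (x - !₂[-(σ * m t), 0, 0])

theorem sphericalNormal_revolve {σ : ℝ} {m R : ℝ → ℝ} {h ρ : ℝ → ℝ → ℝ} {q : ℝ × ℝ} {t d : ℝ}
    (hd : h q.1 t = σ * (d - m t)) :
    sphericalNormal σ m R t (revolve h ρ q t) =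
      !₂[σ * d / R t, ρ q.1 t / R t * Real.cos q.2, ρ q.1 t / R t * Real.sin q.2] := by
  ext i
  fin_cases i
  · simp [sphericalNormal, revolve, hd]; ring
  · simp [sphericalNormal, revolve]; ring
  · simp [sphericalNormal, revolve]; ring

/-- The chart of the cap of a spherical piece. -/
noncomputable abbrev capChart (σ : ℝ) (m R : ℝ → ℝ) : ℝ × ℝ → ℝ → E3 :=
  revolve (capHeight σ m R) (capRadius R)

/-- The chart of the zone of a spherical piece. -/
noncomputable abbrev zoneChart (σ : ℝ) (m R k : ℝ → ℝ) : ℝ × ℝ → ℝ → E3 :=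
  revolve (zoneHeight σ m R k) (zoneRadius R k)

/-- The motion velocity of a spherical piece. -/
noncomputable abbrev sphericalVelocity (σ : ℝ) (m R k : ℝ → ℝ) : E3 → ℝ → E3 :=
  twoChartVelocity (capChart σ m R) capDomain (zoneChart σ m R k) closedDomain

namespace IsSphericalData

variable {I : Set ℝ} {σ : ℝ} {m R k : ℝ → ℝ} {t : ℝ}

theorem sign_mul_cancel (h : IsSphericalData I σ m R k) (x : ℝ) : σ * (σ * x) = x := by
  linear_combination x * h.sign

theorem sign_ne_zero (h : IsSphericalData I σ m R k) : σ ≠ 0 := by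
  rintro rfl
  simpa using h.sign

theorem depth_capChart (h : IsSphericalData I σ m R k) (ht : t ∈ I) (q : ℝ × ℝ) :
    σ * capChart σ m R q t 0 + m t = -(R t * √(1 - 3 * q.1 ^ 2 / 4)) := by
  have : capChart σ m R q t 0 = σ * (-(R t * √(1 - 3 * q.1 ^ 2 / 4)) - m t) :=
    h.capHeight_eq ht q.1
  rw [this, h.sign_mul_cancel]
  ring

theorem depth_zoneChart (h : IsSphericalData I σ m R k) (q : ℝ × ℝ) :
    σ * zoneChart σ m R k q t 0 + m t = zoneDepth R k q.1 t := by
  have : zoneChart σ m R k q t 0 = σ * (zoneDepth R k q.1 t - m t) := rfl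
  rw [this, h.sign_mul_cancel]
  ring

/-- The depth `-R/2` separates the two charts: `√(1 - 3r²/4)` falls to `1/2` only at the excluded
parameter `r = 1`. -/
theorem depth_capChart_lt (h : IsSphericalData I σ m R k) (ht : t ∈ I) {q : ℝ × ℝ}
    (hq : q ∈ capDomain) : σ * capChart σ m R q t 0 + m t < -(R t / 2) := by
  rw [h.depth_capChart ht]
  have hR := h.R_pos t ht
  have h1 : 1 / 2 < √(1 - 3 * q.1 ^ 2 / 4) := by
    refine Real.lt_sqrt_of_sq_lt ?_
    nlinarith [hq.1.1, hq.1.2]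
  nlinarith

theorem le_depth_zoneChart (h : IsSphericalData I σ m R k) (ht : t ∈ I) {q : ℝ × ℝ}
    (hq : 0 ≤ q.1) : -(R t / 2) ≤ σ * zoneChart σ m R k q t 0 + m t := by
  rw [h.depth_zoneChart, zoneDepth]
  have := mul_nonneg (h.k_pos t ht).le hq
  linarith

theorem zoneChart_ne_capChart (h : IsSphericalData I σ m R k) (ht : t ∈ I) :
    ∀ p ∈ capDomain, ∀ q ∈ closedDomain, zoneChart σ m R k q t ≠ capChart σ m R p t := by
  intro p hp q hq he
  have h1 := h.depth_capChart_lt ht hp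
  have h2 := h.le_depth_zoneChart ht hq.1.1
  rw [he] at h2
  exact absurd h1 (not_lt.2 h2)

theorem sq_add_sq (h : IsSphericalData I σ m R k) (x : E3) :
    (x 0 + σ * m t) ^ 2 = (σ * x 0 + m t) ^ 2 := by
  linear_combination (m t ^ 2 - x 0 ^ 2) * h.sign

theorem depth_sq_add_capRadius_sq (r : ℝ) (hr : r ∈ Icc (0 : ℝ) 1) :
    (R t * √(1 - 3 * r ^ 2 / 4)) ^ 2 + capRadius R r t ^ 2 = R t ^ 2 := by
  have h3 : (√3) ^ 2 = 3 := Real.sq_sqrt (by norm_num)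
  have h1 := Real.sq_sqrt (one_sub_pos hr).le
  rw [capRadius]
  linear_combination R t ^ 2 * h1 + R t ^ 2 * r ^ 2 / 4 * h3

theorem capChart_mem (h : IsSphericalData I σ m R k) (ht : t ∈ I) {q : ℝ × ℝ}
    (hq : q ∈ capDomain) : capChart σ m R q t ∈ sphericalPiece σ m R k t := by
  constructor
  · have h1 := depth_sq_add_capRadius_sq (R := R) (t := t) q.1 (Ico_subset_Icc_self hq.1)
    rw [add_assoc, revolve_sq, h.sq_add_sq, h.depth_capChart ht, neg_sq, h1]
  · have h1 := h.depth_capChart_lt ht hq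
    have h2 := h.k_pos t ht
    linarith

theorem zoneRadius_sq (h : IsSphericalData I σ m R k) (ht : t ∈ I) {r : ℝ}
    (hr : r ∈ Icc (0 : ℝ) 1) : zoneRadius R k r t ^ 2 = R t ^ 2 - zoneDepth R k r t ^ 2 :=
  Real.sq_sqrt (h.zoneDepth_mem ht hr).le

theorem zoneChart_mem (h : IsSphericalData I σ m R k) (ht : t ∈ I) {q : ℝ × ℝ}
    (hq : q.1 ∈ Ico (0 : ℝ) 1) : zoneChart σ m R k q t ∈ sphericalPiece σ m R k t := by
  constructor
  · rw [add_assoc, revolve_sq, h.sq_add_sq, h.depth_zoneChart,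
      h.zoneRadius_sq ht (Ico_subset_Icc_self hq)]
    ring
  · have h1 := h.depth_zoneChart (t := t) q
    have h2 := h.k_pos t ht
    have h3 : k t * q.1 < k t := by nlinarith [hq.2]
    rw [zoneDepth] at h1
    linarith

theorem exists_capChart_eq (h : IsSphericalData I σ m R k) (ht : t ∈ I) {x : E3}
    (hx : x ∈ sphericalPiece σ m R k t) (hd : σ * x 0 + m t < -(R t / 2)) :
    ∃ q ∈ capDomain, x = capChart σ m R q t := by
  have hR := h.R_pos t ht
  have h3 : (√3) ^ 2 = 3 := Real.sq_sqrt (by norm_num)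
  have h30 : 0 < √3 := Real.sqrt_pos.2 (by norm_num)
  have hs : (σ * x 0 + m t) ^ 2 + (x 1 ^ 2 + x 2 ^ 2) = R t ^ 2 := by
    rw [← h.sq_add_sq, ← add_assoc]; exact hx.1
  set d := σ * x 0 + m t with hddef
  set ρ := √(x 1 ^ 2 + x 2 ^ 2) with hρ
  have hρ2 : ρ ^ 2 = x 1 ^ 2 + x 2 ^ 2 := Real.sq_sqrt (by positivity)
  -- This inverts `capRadius`. The bound `r < 1` holds because depth below `-R/2` leaves less than
  -- `3R²/4` for the square of the distance from the axis.
  set r := ρ / (√3 / 2 * R t) with hr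
  have hrad : capRadius R r t = ρ := by
    rw [capRadius, hr]
    field_simp
  have hr0 : 0 ≤ r := by positivity
  have hr2 : 3 / 4 * R t ^ 2 * r ^ 2 = ρ ^ 2 := by
    rw [← hrad, capRadius]
    linear_combination (-(R t ^ 2 * r ^ 2 / 4)) * h3
  have hr1 : r < 1 := by
    by_contra hcon
    push Not at hcon
    have h4 : 1 ≤ r ^ 2 := by nlinarith
    have h5 : R t ^ 2 / 4 < d ^ 2 := by nlinarith
    nlinarith [sq_nonneg (R t)]
  have hdep : capHeight σ m R r t = x 0 := by
    have h6 : √(R t ^ 2 - 3 * R t ^ 2 * r ^ 2 / 4) = -d := by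
      have : R t ^ 2 - 3 * R t ^ 2 * r ^ 2 / 4 = (-d) ^ 2 := by linear_combination -hs - hr2 - hρ2
      rw [this, Real.sqrt_sq (by linarith)]
    rw [capHeight, h6, neg_neg, hddef, add_sub_cancel_right, h.sign_mul_cancel]
  obtain ⟨θ, hθ, he⟩ := exists_revolve_eq (h := capHeight σ m R) (ρ := capRadius R) (r := r)
    hdep (by rw [hrad]; positivity) (by rw [hrad, hρ2])
  exact ⟨(r, θ), ⟨⟨hr0, hr1⟩, hθ⟩, he⟩

theorem exists_zoneChart_eq (h : IsSphericalData I σ m R k) (ht : t ∈ I) {x : E3}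
    (hx : x ∈ sphericalPiece σ m R k t) (hd : -(R t / 2) ≤ σ * x 0 + m t) :
    ∃ q ∈ closedDomain, x = zoneChart σ m R k q t := by
  have hk := h.k_pos t ht
  have hs : (σ * x 0 + m t) ^ 2 + (x 1 ^ 2 + x 2 ^ 2) = R t ^ 2 := by
    rw [← h.sq_add_sq, ← add_assoc]; exact hx.1
  have hlt := hx.2
  set d := σ * x 0 + m t with hddef
  -- This inverts `zoneDepth`; the inequality that bounds the piece becomes `r ≤ 1`.
  set r := (d + R t / 2) / k t with hr
  have hr0 : 0 ≤ r := div_nonneg (by linarith) hk.le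
  have hr1 : r ≤ 1 := by rw [hr, div_le_one hk]; linarith
  have hdep : zoneDepth R k r t = d := by
    rw [zoneDepth, hr, mul_div_cancel₀ _ hk.ne']
    ring
  have hheight : zoneHeight σ m R k r t = x 0 := by
    rw [zoneHeight, hdep, hddef, add_sub_cancel_right, h.sign_mul_cancel]
  obtain ⟨θ, hθ, he⟩ := exists_revolve_eq (h := zoneHeight σ m R k) (ρ := zoneRadius R k)
    (r := r) hheight (Real.sqrt_nonneg _)
    (by rw [h.zoneRadius_sq ht ⟨hr0, hr1⟩, hdep]; linarith)
  exact ⟨(r, θ), ⟨⟨hr0, hr1⟩, hθ⟩, he⟩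

theorem sphericalVelocity_capChart (h : IsSphericalData I σ m R k) (ht : t ∈ I) {q : ℝ × ℝ}
    (hq : q ∈ capDomain) : sphericalVelocity σ m R k (capChart σ m R q t) t =
      capField σ m R (capChart σ m R q t) t :=
  twoChartVelocity_eq_of_mem (W := fun x => capField σ m R x t)
    (fun _ _ => h.capField_eq_deriv ht) hq

theorem sphericalVelocity_zoneChart (h : IsSphericalData I σ m R k) (ht : t ∈ I) {q : ℝ × ℝ}
    (hq : q ∈ closedDomain) : sphericalVelocity σ m R k (zoneChart σ m R k q t) t =
      zoneField σ m R k (zoneChart σ m R k q t) t :=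
  twoChartVelocity_eq_of_mem_right (W := fun x => zoneField σ m R k x t)
    (fun _ hp => h.zoneField_eq_deriv ht hp.1) (h.zoneChart_ne_capChart ht) hq

theorem continuous_depth : Continuous fun x : E3 => σ * x 0 + m t := by fun_prop

/-- For a homothety `g' = c = R'/R` and `c' = 0`, so the divergence is `2 R'/R` whatever the normal.
-/
theorem surfDiv_capChart (h : IsSphericalData I σ m R k) (ht : t ∈ I) {q : ℝ × ℝ}
    (hq : q ∈ openDomain) :
    DifferentiableWithinAt ℝ (fun y => sphericalVelocity σ m R k y t)
      (sphericalPiece σ m R k t) (capChart σ m R q t) ∧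
    surfDiv (sphericalPiece σ m R k t) (sphericalNormal σ m R t)
      (fun y => sphericalVelocity σ m R k y t) (capChart σ m R q t) =
        deriv (fun s => R s ^ 2) t / R t ^ 2 := by
  have hr : q.1 ∈ Icc (0 : ℝ) 1 := Ioo_subset_Icc_self hq.1
  have hR := h.R_pos t ht
  have h3 : (√3) ^ 2 = 3 := Real.sq_sqrt (by norm_num)
  have h30 : 0 < √3 := Real.sqrt_pos.2 (by norm_num)
  have hκ := Real.sqrt_pos.2 (one_sub_pos hr)
  have hsph := depth_sq_add_capRadius_sq (R := R) (t := t) q.1 hr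
  -- The strict inequality for the depth persists nearby, so all nearby points of the piece lie in
  -- the cap, where the velocity is the smooth field.
  have hw : (fun y => sphericalVelocity σ m R k y t)
      =ᶠ[𝓝[sphericalPiece σ m R k t] (capChart σ m R q t)]
      axialField (fun ξ => deriv R t / R t * (ξ + σ * m t) - σ * deriv m t)
        (fun _ => deriv R t / R t) := by
    have hev := (continuous_depth (σ := σ) (m := m) (t := t)).continuousAt.eventually_lt
      continuousAt_const (h.depth_capChart_lt ht (openDomain_subset_capDomain hq))
    filter_upwards [self_mem_nhdsWithin, mem_nhdsWithin_of_mem_nhds hev] with y hy hyd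
    obtain ⟨p, hp, rfl⟩ := h.exists_capChart_eq ht hy hyd
    exact h.sphericalVelocity_capChart ht hp
  obtain ⟨r1, r2⟩ := surfDiv_revolve (n := sphericalNormal σ m R t)
    ((h.isFlowChart_cap.contDiffAt ht (openDomain_subset_closedDomain hq)).differentiableAt
      one_ne_zero)
    (h.hasDerivAt_capHeight ht hr) (hasDerivAt_capRadius (R := R) (s := t)) (by positivity)
    (mul_pos (by positivity) hq.1.1)
    (eventually_mem_openDomain hq fun p hp => h.capChart_mem ht (openDomain_subset_capDomain hp))
    hw ((((hasDerivAt_id _).add_const (σ * m t)).const_mul (deriv R t / R t)).sub_const _)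
    (hasDerivAt_const _ _)
    (sphericalNormal_revolve (d := -(R t * √(1 - 3 * q.1 ^ 2 / 4))) (h.capHeight_eq ht q.1))
    (by
      rw [div_pow, div_pow, mul_pow, h.sign, ← add_div, one_mul, neg_sq, hsph,
        div_self (pow_pos hR 2).ne'])
    (by
      rw [capRadius]
      generalize √(1 - 3 * q.1 ^ 2 / 4) = κ at hκ
      field_simp
      linear_combination (-12 * R t * q.1) * h.sign + 4 * R t * q.1 * h3)
  refine ⟨r1, ?_⟩
  rw [r2]
  have hd : deriv (fun s => R s ^ 2) t = 2 * R t * deriv R t := by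
    have h1 : HasDerivAt (fun s => R s ^ 2) _ t :=
      (hasDerivAt_of_contDiffOn h.isOpen h.R_smooth ht).pow 2
    rw [h1.deriv]
    norm_num
  rw [hd]
  field_simp
  ring

/-- The target is `R'/R + k'/k`. The radial coefficient depends on the height here, so the term with
`c'` contributes, and the sphere equation is needed to simplify the sum. -/
theorem surfDiv_zoneChart (h : IsSphericalData I σ m R k) (ht : t ∈ I) {q : ℝ × ℝ}
    (hq : q ∈ openDomain) :
    DifferentiableWithinAt ℝ (fun y => sphericalVelocity σ m R k y t)
      (sphericalPiece σ m R k t) (zoneChart σ m R k q t) ∧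
    surfDiv (sphericalPiece σ m R k t) (sphericalNormal σ m R t)
      (fun y => sphericalVelocity σ m R k y t) (zoneChart σ m R k q t) =
        deriv (fun s => R s * k s) t / (R t * k t) := by
  have hr : q.1 ∈ Icc (0 : ℝ) 1 := Ioo_subset_Icc_self hq.1
  have hR := h.R_pos t ht
  have hk := h.k_pos t ht
  have hσ := h.sign_ne_zero
  have hp := h.zoneDepth_mem ht hr
  have hρ2 := h.zoneRadius_sq ht hr
  have hρ0 : 0 < zoneRadius R k q.1 t := Real.sqrt_pos.2 hp
  have hw : (fun y => sphericalVelocity σ m R k y t)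
      =ᶠ[𝓝[sphericalPiece σ m R k t] (zoneChart σ m R k q t)]
      axialField (fun ξ => σ * (zoneRate R k t (σ * ξ + m t) - deriv m t))
        (fun ξ => (R t * deriv R t - (σ * ξ + m t) * zoneRate R k t (σ * ξ + m t)) /
          (R t ^ 2 - (σ * ξ + m t) ^ 2)) := by
    -- Interior parameters have `r > 0`, which keeps the point off the seam with the cap; only there
    -- is a whole neighbourhood in the piece covered by the zone.
    have hlt : -(R t / 2) < σ * zoneChart σ m R k q t 0 + m t := by
      rw [h.depth_zoneChart, zoneDepth]
      have := mul_pos hk hq.1.1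
      linarith
    have hev := (continuousAt_const (y := -(R t / 2))).eventually_lt
      (continuous_depth (σ := σ) (m := m) (t := t)).continuousAt hlt
    filter_upwards [self_mem_nhdsWithin, mem_nhdsWithin_of_mem_nhds hev] with y hy hyd
    obtain ⟨p, hp, rfl⟩ := h.exists_zoneChart_eq ht hy hyd.le
    exact h.sphericalVelocity_zoneChart ht hp
  set y := zoneDepth R k q.1 t with hy
  have hξ : σ * zoneHeight σ m R k q.1 t + m t = y := by
    rw [zoneHeight, h.sign_mul_cancel]; ring
  have hdepth : HasDerivAt (fun ξ => σ * ξ + m t) σ (zoneHeight σ m R k q.1 t) := by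
    simpa using ((hasDerivAt_id (zoneHeight σ m R k q.1 t)).const_mul σ).add_const (m t)
  have hrate : HasDerivAt (fun ξ => zoneRate R k t (σ * ξ + m t)) (deriv k t / k t * σ)
      (zoneHeight σ m R k q.1 t) :=
    ((hdepth.add_const (R t / 2)).const_mul _).sub_const _
  have hg : HasDerivAt (fun ξ => σ * (zoneRate R k t (σ * ξ + m t) - deriv m t))
      (deriv k t / k t) (zoneHeight σ m R k q.1 t) := by
    refine ((hrate.sub_const (deriv m t)).const_mul σ).congr_deriv ?_
    linear_combination deriv k t / k t * h.sign
  set N := R t * deriv R t - y * zoneRate R k t y with hN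
  -- The quotient rule for the radial coefficient as a function of depth; the chain rule contributes
  -- the factor `σ`.
  set c' := σ * ((-(zoneRate R k t y + y * (deriv k t / k t)) * (R t ^ 2 - y ^ 2) + 2 * y * N) /
    (R t ^ 2 - y ^ 2) ^ 2) with hc'
  have hc : HasDerivAt
      (fun ξ => (R t * deriv R t - (σ * ξ + m t) * zoneRate R k t (σ * ξ + m t)) /
          (R t ^ 2 - (σ * ξ + m t) ^ 2)) c' (zoneHeight σ m R k q.1 t) := by
    have h1 := ((hdepth.mul hrate).const_sub (R t * deriv R t)).div
      ((hdepth.pow 2).const_sub (R t ^ 2)) (by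
        simp only [Pi.pow_apply, hξ]
        exact hp.ne')
    refine HasDerivAt.congr_deriv h1 ?_
    simp only [Pi.mul_apply, Pi.pow_apply, hξ, ← hN, hc']
    field_simp
    norm_num
    ring
  obtain ⟨r1, r2⟩ := surfDiv_revolve (n := sphericalNormal σ m R t)
    ((h.isFlowChart_zone.contDiffAt ht (openDomain_subset_closedDomain hq)).differentiableAt
      one_ne_zero)
    (hasDerivAt_zoneHeight (σ := σ) (m := m) (R := R) (k := k) (s := t))
    (h.hasDerivAt_zoneRadius ht hr) (by positivity) hρ0
    (eventually_mem_openDomain hq fun p hp => h.zoneChart_mem ht (Ioo_subset_Ico_self hp.1))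
    hw hg hc (sphericalNormal_revolve (d := y) rfl)
    (by
      rw [div_pow, div_pow, mul_pow, h.sign, ← add_div, hρ2]
      field_simp
      ring)
    (by
      field_simp
      linear_combination y * k t * h.sign)
  refine ⟨r1, ?_⟩
  rw [r2]
  have hd : deriv (fun s => R s * k s) t = deriv R t * k t + R t * deriv k t := by
    have h1 : HasDerivAt (fun s => R s * k s) _ t :=
      (hasDerivAt_of_contDiffOn h.isOpen h.R_smooth ht).mul
        (hasDerivAt_of_contDiffOn h.isOpen h.k_smooth ht)
    exact h1.deriv
  have e0 : (σ * y / R t) ^ 2 = y ^ 2 / R t ^ 2 := by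
    rw [div_pow, mul_pow, h.sign, one_mul]
  -- The sign and the root occur only squared: `σ² = 1`, and `ρ² = R² - y²` cancels one factor of
  -- the denominator.
  have e1 : c' * (σ * y / R t) * (zoneRadius R k q.1 t / R t) * zoneRadius R k q.1 t =
      (-(zoneRate R k t y + y * (deriv k t / k t)) * (R t ^ 2 - y ^ 2) + 2 * y * N) /
        (R t ^ 2 - y ^ 2) * y / R t ^ 2 := by
    have : c' * (σ * y / R t) * (zoneRadius R k q.1 t / R t) * zoneRadius R k q.1 t =
        σ ^ 2 * zoneRadius R k q.1 t ^ 2 *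
          ((-(zoneRate R k t y + y * (deriv k t / k t)) * (R t ^ 2 - y ^ 2) + 2 * y * N) /
            (R t ^ 2 - y ^ 2) ^ 2) * y / R t ^ 2 := by
      rw [hc']; ring
    rw [this, h.sign, hρ2]
    have := hp.ne'
    field_simp
  rw [hd, e0, e1, hξ, ← hN]
  have := hp.ne'
  rw [hN]
  field_simp
  ring

end IsSphericalData

/-! ### Velocity and transport on a whole spherical piece -/

namespace IsSphericalData

variable {I : Set ℝ} {σ : ℝ} {m R k : ℝ → ℝ} {t : ℝ}

theorem sphericalVelocity_eq_deriv (h : IsSphericalData I σ m R k) (ht : t ∈ I) :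
    (∀ q ∈ capDomain, sphericalVelocity σ m R k (capChart σ m R q t) t =
      deriv (fun s => capChart σ m R q s) t) ∧
    (∀ q ∈ closedDomain, sphericalVelocity σ m R k (zoneChart σ m R k q t) t =
      deriv (fun s => zoneChart σ m R k q s) t) :=
  ⟨fun _ hq => (h.sphericalVelocity_capChart ht hq).trans (h.capField_eq_deriv ht),
    fun _ hq => (h.sphericalVelocity_zoneChart ht hq).trans (h.zoneField_eq_deriv ht hq.1)⟩

theorem ae_differentiableWithinAt (h : IsSphericalData I σ m R k) (ht : t ∈ I) :
    ∀ᵐ x ∂((μHE[2] : Measure E3).restrict (sphericalPiece σ m R k t)),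
      DifferentiableWithinAt ℝ (fun y => sphericalVelocity σ m R k y t)
        (sphericalPiece σ m R k t) x := by
  have hsub : sphericalPiece σ m R k t ⊆ (fun q => capChart σ m R q t) '' capDomain ∪
      (fun q => zoneChart σ m R k q t) '' closedDomain := by
    intro x hx
    rcases lt_or_ge (σ * x 0 + m t) (-(R t / 2)) with hd | hd
    · obtain ⟨q, hq, rfl⟩ := h.exists_capChart_eq ht hx hd
      exact Or.inl ⟨q, hq, rfl⟩
    · obtain ⟨q, hq, rfl⟩ := h.exists_zoneChart_eq ht hx hd
      exact Or.inr ⟨q, hq, rfl⟩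
  refine Filter.Eventually.filter_mono (ae_mono (Measure.restrict_mono_set _ hsub)) ?_
  rw [ae_restrict_union_iff]
  exact ⟨h.isFlowChart_cap.ae_restrict_image ht nullMeasurableSet_capDomain
      capDomain_subset_closedDomain fun q hq => (h.surfDiv_capChart ht hq.2).1,
    h.isFlowChart_zone.ae_restrict_image ht nullMeasurableSet_closedDomain Subset.rfl
      fun q hq => (h.surfDiv_zoneChart ht hq.2).1⟩

/-- The transport theorem on a spherical piece. -/
theorem transport (h : IsSphericalData I σ m R k) {U V : Set (ℝ × ℝ)}
    (hU : NullMeasurableSet U) (hV : NullMeasurableSet V) (hUK : U ⊆ capDomain)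
    (hVK : V ⊆ closedDomain) {Ω : ℝ → Set E3}
    (hΩ : ∀ s ∈ I, Ω s =
      (fun q => capChart σ m R q s) '' U ∪ (fun q => zoneChart σ m R k q s) '' V)
    {f : E3 → ℝ → ℝ} (hf : ContDiff ℝ 1 (fun q : E3 × ℝ => f q.1 q.2)) (ht : t ∈ I) :
    IntegrableOn (fun x => f x t) (Ω t) μHE[2] ∧
    IntegrableOn (fun x => materialDeriv (sphericalVelocity σ m R k) f x t +
      surfDiv (sphericalPiece σ m R k t) (sphericalNormal σ m R t)
        (fun y => sphericalVelocity σ m R k y t) x * f x t) (Ω t) μHE[2] ∧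
    HasDerivAt (fun s => ∫ x in Ω s, f x s ∂μHE[2])
      (∫ x in Ω t, (materialDeriv (sphericalVelocity σ m R k) f x t +
        surfDiv (sphericalPiece σ m R k t) (sphericalNormal σ m R t)
          (fun y => sphericalVelocity σ m R k y t) x * f x t) ∂μHE[2]) t := by
  have hA := fun s (hs : s ∈ I) => h.isFlowChart_cap.transport_surfDiv h.isOpen hs
    (fun q _ => h.capField_eq_deriv hs) (measurable_capField σ m R s) hU
    (hUK.trans capDomain_subset_closedDomain)
    (fun q hq => h.sphericalVelocity_capChart hs (hUK hq))
    (fun q hq => (h.surfDiv_capChart hs hq).2) hf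
  have hB := fun s (hs : s ∈ I) => h.isFlowChart_zone.transport_surfDiv h.isOpen hs
    (fun q hq => h.zoneField_eq_deriv hs hq.1) (measurable_zoneField σ m R k s) hV hVK
    (fun q hq => h.sphericalVelocity_zoneChart hs (hVK hq))
    (fun q hq => (h.surfDiv_zoneChart hs hq).2) hf
  refine hasDerivAt_setIntegral_union h.isOpen ht hΩ (fun s hs => ?_)
    (fun s hs => h.isFlowChart_zone.nullMeasurableSet_image hs hV hVK)
    (fun s hs => (hA s hs).1) (fun s hs => (hB s hs).1) (hA t ht).2.1 (hB t ht).2.1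
    (hA t ht).2.2 (hB t ht).2.2
  rw [disjoint_left]
  rintro _ ⟨p, hp, rfl⟩ ⟨q, hq, he⟩
  exact h.zoneChart_ne_capChart hs p (hUK hp) q (hVK hq) he

end IsSphericalData

/-! ### The separating disc -/

/-- The flat disc. -/
def disc (ν ρ : ℝ → ℝ) (t : ℝ) : Set E3 := {x | x 0 = ν t ∧ x 1 ^ 2 + x 2 ^ 2 ≤ ρ t ^ 2}

/-- The chart of the disc. -/
noncomputable abbrev discChart (ν ρ : ℝ → ℝ) : ℝ × ℝ → ℝ → E3 :=
  revolve (fun _ s => ν s) (fun r s => ρ s * r)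

/-- The velocity of the disc, as a field on space. -/
noncomputable def discField (ν ρ : ℝ → ℝ) (x : E3) (t : ℝ) : E3 :=
  axialField (fun _ => deriv ν t) (fun _ => deriv ρ t / ρ t) x

section Disc

variable {I : Set ℝ} {ν ρ : ℝ → ℝ} {t : ℝ}

theorem discChart_mem {q : ℝ × ℝ} (hq : q.1 ∈ Icc (0 : ℝ) 1) :
    discChart ν ρ q t ∈ disc ν ρ t := by
  refine ⟨rfl, ?_⟩
  rw [revolve_sq]
  have h1 : q.1 ^ 2 ≤ 1 := by nlinarith [hq.1, hq.2]
  nlinarith [sq_nonneg (ρ t)]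

theorem exists_discChart_eq (hρ : 0 < ρ t) {x : E3} (hx : x ∈ disc ν ρ t) :
    ∃ q ∈ closedDomain, x = discChart ν ρ q t := by
  have h0 : 0 ≤ x 1 ^ 2 + x 2 ^ 2 := by positivity
  have hmul : ρ t * (√(x 1 ^ 2 + x 2 ^ 2) / ρ t) = √(x 1 ^ 2 + x 2 ^ 2) :=
    mul_div_cancel₀ _ hρ.ne'
  obtain ⟨θ, hθ, he⟩ := exists_revolve_eq (h := fun _ s => ν s) (ρ := fun r s => ρ s * r)
    (r := √(x 1 ^ 2 + x 2 ^ 2) / ρ t) (t := t) (x := x) hx.1.symm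
    (by rw [hmul]; exact Real.sqrt_nonneg _) (by rw [hmul, Real.sq_sqrt h0])
  refine ⟨(_, θ), ⟨⟨by positivity, ?_⟩, hθ⟩, he⟩
  rw [div_le_one hρ]
  exact (Real.sqrt_le_left hρ.le).2 hx.2

theorem discField_eq_deriv (hI : IsOpen I) (hν : ContDiffOn ℝ 1 ν I) (hρ : ContDiffOn ℝ 1 ρ I)
    (hρ0 : ∀ s ∈ I, 0 < ρ s) (ht : t ∈ I) {q : ℝ × ℝ} :
    discField ν ρ (discChart ν ρ q t) t = deriv (discChart ν ρ q) t := by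
  have h1 := hasDerivAt_of_contDiffOn hI hν ht
  have h2 := hasDerivAt_of_contDiffOn hI hρ ht
  refine axialField_revolve h1 (h2.mul_const q.1) rfl ?_
  have := (hρ0 t ht).ne'
  field_simp

/-- The normal is axial and the field is uniform along the axis, so only the radial scaling counts,
giving `2 ρ'/ρ`. -/
theorem surfDiv_discChart (hI : IsOpen I) (hν : ContDiffOn ℝ 1 ν I) (hρ : ContDiffOn ℝ 1 ρ I)
    (hρ0 : ∀ s ∈ I, 0 < ρ s) (ht : t ∈ I) {w : E3 → E3}
    (hw : ∀ x ∈ disc ν ρ t, w x = discField ν ρ x t) {q : ℝ × ℝ} (hq : q ∈ openDomain) :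
    DifferentiableWithinAt ℝ w (disc ν ρ t) (discChart ν ρ q t) ∧
    surfDiv (disc ν ρ t) (fun _ => !₂[1, 0, 0]) w (discChart ν ρ q t) =
      deriv (fun s => ρ s ^ 2) t / ρ t ^ 2 := by
  have h2 := hasDerivAt_of_contDiffOn hI hρ ht
  have hpos := hρ0 t ht
  obtain ⟨r1, r2⟩ := surfDiv_revolve (Γ := disc ν ρ t) (w := w) (n := fun _ => !₂[1, 0, 0])
    (n₀ := 1) (n₁ := 0)
    (((isFlowChart_disc hI hν hρ hρ0).contDiffAt ht
      (openDomain_subset_closedDomain hq)).differentiableAt one_ne_zero)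
    (hasDerivAt_const q.1 (ν t))
    (((hasDerivAt_id q.1).const_mul (ρ t)).congr_deriv (mul_one (ρ t)))
    (by positivity) (mul_pos hpos hq.1.1)
    (eventually_mem_openDomain hq fun p hp =>
      discChart_mem (Ioo_subset_Icc_self hp.1))
    (eventually_nhdsWithin_of_forall hw)
    (hasDerivAt_const _ _) (hasDerivAt_const _ _) (by simp) (by norm_num) (by simp)
  refine ⟨r1, r2.trans ?_⟩
  have h1 : HasDerivAt (fun s => ρ s ^ 2) _ t := h2.pow 2
  rw [h1.deriv]
  norm_num
  field_simp

end Disc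

/-! ### Identification of the three pieces -/

theorem xA1_eq (m a : ℝ → ℝ) : xA1 m a = capChart 1 m a := by
  funext p t
  simp only [xA1, revolve, capHeight, capRadius, one_mul]

theorem xB2_eq (m b : ℝ → ℝ) : xB2 m b = capChart (-1) m b := by
  funext p t
  simp only [xB2, revolve, capHeight, capRadius]
  congr 2
  ring

theorem xA2_eq (m a b : ℝ → ℝ) :
    xA2 m a b = zoneChart 1 m a (fun t => m t + planeCoord m a b t + a t / 2) := by
  funext p t
  have hy : zoneDepth a (fun t => m t + planeCoord m a b t + a t / 2) p.1 t =
      yA2 m a b p.1 t := by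
    rw [zoneDepth, yA2]; ring
  simp only [xA2, revolve, zoneHeight, zoneRadius, one_mul, hy]

theorem xB1_eq (m a b : ℝ → ℝ) :
    xB1 m a b = zoneChart (-1) m b (fun t => m t - planeCoord m a b t + b t / 2) := by
  funext p t
  have hy : zoneDepth b (fun t => m t - planeCoord m a b t + b t / 2) p.1 t =
      yB1 m a b p.1 t := by
    rw [zoneDepth, yB1]; ring
  simp only [xB1, revolve, zoneHeight, zoneRadius, hy]
  congr 2
  ring

theorem Gam_A_eq (m a b : ℝ → ℝ) (t : ℝ) : Gam m a b Piece.A t =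
    sphericalPiece 1 m a (fun t => m t + planeCoord m a b t + a t / 2) t := by
  ext x
  have : m t + planeCoord m a b t + a t / 2 - m t - a t / 2 = planeCoord m a b t := by ring
  simp only [Gam, sphericalPiece, mem_ofPred_eq, one_mul, this]

theorem Gam_B_eq (m a b : ℝ → ℝ) (t : ℝ) : Gam m a b Piece.B t =
    sphericalPiece (-1) m b (fun t => m t - planeCoord m a b t + b t / 2) t := by
  ext x
  have : m t - planeCoord m a b t + b t / 2 - m t - b t / 2 = -planeCoord m a b t := by ring
  simp only [Gam, sphericalPiece, mem_ofPred_eq, neg_mul, one_mul, this, neg_lt_neg_iff,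
    ← sub_eq_add_neg]

theorem normal_A_eq (m a b : ℝ → ℝ) (t : ℝ) :
    normal m a b Piece.A t = sphericalNormal 1 m a t := by
  funext x
  simp only [normal, sphericalNormal, one_mul]

theorem normal_B_eq (m a b : ℝ → ℝ) (t : ℝ) :
    normal m a b Piece.B t = sphericalNormal (-1) m b t := by
  funext x
  simp only [normal, sphericalNormal, neg_mul, one_mul, neg_neg]

theorem Gam_S_eq (m a b : ℝ → ℝ) {t : ℝ} (h : 0 ≤ a t ^ 2 - (m t + planeCoord m a b t) ^ 2) :
    Gam m a b Piece.S t = disc (planeCoord m a b)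
      (fun t => √(a t ^ 2 - (m t + planeCoord m a b t) ^ 2)) t := by
  ext x
  simp only [Gam, disc, mem_ofPred_eq, Real.sq_sqrt h]
  constructor
  · rintro ⟨h1, h2⟩
    rw [h2] at h1
    exact ⟨h2, by linarith⟩
  · rintro ⟨h2, h1⟩
    rw [h2]
    exact ⟨by linarith, rfl⟩

/-! ### The time interval and the position of the separating plane -/

theorem isOpen_openTimeInterval (T : EReal) : IsOpen (openTimeInterval T) :=
  isOpen_Ioi.inter (isOpen_Iio.preimage continuous_coe_real_ereal)

theorem openTimeInterval_subset (T : EReal) : openTimeInterval T ⊆ timeInterval T :=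
  fun _ ht => ⟨ht.1.le, ht.2⟩

theorem contDiffOn_planeCoord {I : Set ℝ} {m a b : ℝ → ℝ} (hm : ContDiffOn ℝ 1 m I)
    (ha : ContDiffOn ℝ 1 a I) (hb : ContDiffOn ℝ 1 b I) (h0 : ∀ t ∈ I, m t ≠ 0) :
    ContDiffOn ℝ 1 (planeCoord m a b) I :=
  ((ha.pow 2).sub (hb.pow 2)).div (contDiffOn_const.mul hm) fun t ht =>
    mul_ne_zero four_ne_zero (h0 t ht)

section PlaneCoord

variable {m a b : ℝ → ℝ} {t : ℝ}

theorem planeCoord_neg (h : 0 < m t ∧ m t < a t ∧ a t < b t ∧ b t < 2 * m t) :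
    planeCoord m a b t < 0 := by
  obtain ⟨h1, h2, h3, h4⟩ := h
  exact div_neg_of_neg_of_pos (by nlinarith) (by linarith)

theorem add_planeCoord_pos (h : 0 < m t ∧ m t < a t ∧ a t < b t ∧ b t < 2 * m t) :
    0 < m t + planeCoord m a b t := by
  obtain ⟨h1, h2, h3, h4⟩ := h
  have : m t + planeCoord m a b t = (4 * m t ^ 2 + a t ^ 2 - b t ^ 2) / (4 * m t) := by
    rw [planeCoord]
    field_simp
    ring
  rw [this]
  exact div_pos (by nlinarith) (by linarith)

/-- The factorization `4m (b - m + n) = a² - (2m - b)²` with `n = planeCoord m a b t` expresses that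
the spheres overlap: `a` exceeds `2m - b` since both radii exceed `m`. This is the bound `k_lt` for
the piece `B`. -/
theorem sub_planeCoord_lt (h : 0 < m t ∧ m t < a t ∧ a t < b t ∧ b t < 2 * m t) :
    m t - planeCoord m a b t < b t := by
  obtain ⟨h1, h2, h3, h4⟩ := h
  have : b t - (m t - planeCoord m a b t) =
      ((a t - (2 * m t - b t)) * (a t + (2 * m t - b t))) / (4 * m t) := by
    rw [planeCoord]
    field_simp
    ring
  have h5 : 0 < ((a t - (2 * m t - b t)) * (a t + (2 * m t - b t))) / (4 * m t) :=
    div_pos (mul_pos (by linarith) (by linarith)) (by linarith)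
  linarith

/-- Since `-m < planeCoord < 0`, the plane is at distance less than `m < a` from the center of the
first sphere. -/
theorem discRadius_sq_pos (h : 0 < m t ∧ m t < a t ∧ a t < b t ∧ b t < 2 * m t) :
    0 < a t ^ 2 - (m t + planeCoord m a b t) ^ 2 := by
  have h1 := add_planeCoord_pos h
  have h2 := planeCoord_neg h
  obtain ⟨h3, h4, h5, h6⟩ := h
  nlinarith

end PlaneCoord

section Data

variable {I : Set ℝ} {m a b : ℝ → ℝ}

theorem isSphericalData_A (hI : IsOpen I) (hm : ContDiffOn ℝ 1 m I) (ha : ContDiffOn ℝ 1 a I)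
    (hb : ContDiffOn ℝ 1 b I)
    (h : ∀ t ∈ I, 0 < m t ∧ m t < a t ∧ a t < b t ∧ b t < 2 * m t) :
    IsSphericalData I 1 m a (fun t => m t + planeCoord m a b t + a t / 2) where
  isOpen := hI
  sign := one_pow 2
  m_smooth := hm
  R_smooth := ha
  k_smooth := (hm.add (contDiffOn_planeCoord hm ha hb fun t ht => (h t ht).1.ne')).add
    (ha.div_const 2)
  R_pos t ht := (h t ht).1.trans (h t ht).2.1
  k_pos t ht := by
    have h1 := add_planeCoord_pos (h t ht)
    have h2 := h t ht
    linarith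
  k_lt t ht := by
    have h1 := planeCoord_neg (h t ht)
    have h2 := h t ht
    linarith

theorem isSphericalData_B (hI : IsOpen I) (hm : ContDiffOn ℝ 1 m I) (ha : ContDiffOn ℝ 1 a I)
    (hb : ContDiffOn ℝ 1 b I)
    (h : ∀ t ∈ I, 0 < m t ∧ m t < a t ∧ a t < b t ∧ b t < 2 * m t) :
    IsSphericalData I (-1) m b (fun t => m t - planeCoord m a b t + b t / 2) where
  isOpen := hI
  sign := by norm_num
  m_smooth := hm
  R_smooth := hb
  k_smooth := (hm.sub (contDiffOn_planeCoord hm ha hb fun t ht => (h t ht).1.ne')).add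
    (hb.div_const 2)
  R_pos t ht := by
    have h2 := h t ht
    linarith
  k_pos t ht := by
    have h1 := planeCoord_neg (h t ht)
    have h2 := h t ht
    linarith
  k_lt t ht := by
    have h1 := sub_planeCoord_lt (h t ht)
    linarith

end Data

theorem velocity_A_eq (m a b : ℝ → ℝ) : velocity m a b Piece.A =
    sphericalVelocity 1 m a (fun t => m t + planeCoord m a b t + a t / 2) := by
  simp only [velocity, xA1_eq, xA2_eq]

theorem velocity_B_eq (m a b : ℝ → ℝ) : velocity m a b Piece.B =
    sphericalVelocity (-1) m b (fun t => m t - planeCoord m a b t + b t / 2) := by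
  simp only [velocity, xB1_eq, xB2_eq]

end DoubleBubble

/-! ### The transport theorem on the double bubble -/

open DoubleBubble in
theorem proposition5p2 (T : EReal) (hT : 0 < T) (m a b : ℝ → ℝ)
    (hm : ContDiffOn ℝ 1 m (DoubleBubble.timeInterval T))
    (ha : ContDiffOn ℝ 1 a (DoubleBubble.timeInterval T))
    (hb : ContDiffOn ℝ 1 b (DoubleBubble.timeInterval T))
    (hmab : ∀ t ∈ DoubleBubble.timeInterval T,
      0 < m t ∧ m t < a t ∧ a t < b t ∧ b t < 2 * m t)
    (p : DoubleBubble.Piece) :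
    -- the motion velocity is well defined, and differentiable on almost all of the surface
    DoubleBubble.IsMotionVelocity T m a b p (DoubleBubble.velocity m a b p) ∧
    (∀ t ∈ DoubleBubble.openTimeInterval T,
      ∀ᵐ x ∂((μHE[2] : MeasureTheory.Measure DoubleBubble.E3).restrict
          (DoubleBubble.Gam m a b p t)),
        DifferentiableWithinAt ℝ (fun y => DoubleBubble.velocity m a b p y t)
          (DoubleBubble.Gam m a b p t) x) ∧
    -- the transport theorem
    ∀ f : DoubleBubble.E3 → ℝ → ℝ,
      ContDiff ℝ 1 (fun q : DoubleBubble.E3 × ℝ => f q.1 q.2) →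
      ∀ Ω : ℝ → Set DoubleBubble.E3, DoubleBubble.IsMovingPortion T m a b p Ω →
        ∀ t ∈ DoubleBubble.openTimeInterval T,
          MeasureTheory.IntegrableOn (fun x => f x t) (Ω t) μHE[2] ∧
          MeasureTheory.IntegrableOn
            (fun x => DoubleBubble.transportIntegrand m a b p f x t) (Ω t) μHE[2] ∧
          HasDerivAt (fun s : ℝ => ∫ x in Ω s, f x s ∂μHE[2])
            (∫ x in Ω t, DoubleBubble.transportIntegrand m a b p f x t ∂μHE[2]) t := by
  have hsub := openTimeInterval_subset T
  have hI := isOpen_openTimeInterval T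
  replace hm := hm.mono hsub
  replace ha := ha.mono hsub
  replace hb := hb.mono hsub
  replace hmab : ∀ t ∈ openTimeInterval T, _ := fun t ht => hmab t (hsub ht)
  cases p with
  | A =>
    have hd := isSphericalData_A hI hm ha hb hmab
    simp only [IsMotionVelocity, IsMovingPortion, transportIntegrand, velocity_A_eq, Gam_A_eq,
      normal_A_eq, xA1_eq, xA2_eq]
    refine ⟨fun t ht => hd.sphericalVelocity_eq_deriv ht,
      fun t ht => hd.ae_differentiableWithinAt ht, ?_⟩
    rintro f hf Ω ⟨-, U, V, hU, hV, hUK, hVK, hΩ⟩ t ht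
    exact hd.transport hU hV hUK hVK hΩ hf ht
  | B =>
    have hd := isSphericalData_B hI hm ha hb hmab
    simp only [IsMotionVelocity, IsMovingPortion, transportIntegrand, velocity_B_eq, Gam_B_eq,
      normal_B_eq, xB1_eq, xB2_eq]
    refine ⟨fun t ht => (hd.sphericalVelocity_eq_deriv ht).symm,
      fun t ht => hd.ae_differentiableWithinAt ht, ?_⟩
    rintro f hf Ω ⟨-, U, V, hU, hV, hUK, hVK, hΩ⟩ t ht
    -- On `B` the first chart is the zone and the second the cap, the reverse of the order on `A`.
    exact hd.transport hV hU hVK hUK (fun s hs => (hΩ s hs).trans (union_comm _ _)) hf ht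
  | S =>
    have hν := contDiffOn_planeCoord hm ha hb fun t ht => (hmab t ht).1.ne'
    set ρ : ℝ → ℝ := fun t => √(a t ^ 2 - (m t + planeCoord m a b t) ^ 2) with hρdef
    have hρ0 : ∀ s ∈ openTimeInterval T, 0 < ρ s := fun s hs =>
      Real.sqrt_pos.2 (discRadius_sq_pos (hmab s hs))
    have hρ : ContDiffOn ℝ 1 ρ (openTimeInterval T) :=
      ((ha.pow 2).sub ((hm.add hν).pow 2)).sqrt fun s hs => (discRadius_sq_pos (hmab s hs)).ne'
    have hΓ : ∀ t ∈ openTimeInterval T, Gam m a b Piece.S t = disc (planeCoord m a b) ρ t :=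
      fun t ht => Gam_S_eq m a b (discRadius_sq_pos (hmab t ht)).le
    have hchart := isFlowChart_disc hI hν hρ hρ0
    -- Both slots of `twoChartVelocity` hold the same chart, so the first branch always applies and
    -- no disjointness is needed.
    have hvel : ∀ t ∈ openTimeInterval T, ∀ q ∈ closedDomain,
        velocity m a b Piece.S (xS m a b q t) t =
          discField (planeCoord m a b) ρ (xS m a b q t) t := fun t ht q hq =>
      twoChartVelocity_eq_of_mem (φ := xS m a b) (ψ := xS m a b) (V := closedDomain)
        (W := fun x => discField (planeCoord m a b) ρ x t)
        (fun _ _ => discField_eq_deriv hI hν hρ hρ0 ht) hq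
    have hvel' : ∀ t ∈ openTimeInterval T, ∀ x ∈ disc (planeCoord m a b) ρ t,
        velocity m a b Piece.S x t = discField (planeCoord m a b) ρ x t := by
      intro t ht x hx
      obtain ⟨q, hq, rfl⟩ := exists_discChart_eq (hρ0 t ht) hx
      exact hvel t ht q hq
    have hdiv := fun t (ht : t ∈ openTimeInterval T) q (hq : q ∈ openDomain) =>
      surfDiv_discChart hI hν hρ hρ0 ht (hvel' t ht) hq
    refine ⟨fun t ht q hq => ?_, fun t ht => ?_, ?_⟩
    · exact (hvel t ht q hq).trans (discField_eq_deriv hI hν hρ hρ0 ht)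
    · rw [hΓ t ht]
      have hsub' : disc (planeCoord m a b) ρ t ⊆
          (fun q => discChart (planeCoord m a b) ρ q t) '' closedDomain := by
        intro x hx
        obtain ⟨q, hq, rfl⟩ := exists_discChart_eq (hρ0 t ht) hx
        exact ⟨q, hq, rfl⟩
      refine Eventually.filter_mono (ae_mono (Measure.restrict_mono_set _ hsub')) ?_
      exact hchart.ae_restrict_image ht nullMeasurableSet_closedDomain Subset.rfl
        fun q hq => (hdiv t ht q hq.2).1
    · rintro f hf Ω ⟨-, U, hU, hUK, hΩ⟩ t ht
      obtain ⟨h1, h2, h3⟩ := hchart.transport_surfDiv hI ht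
        (w := velocity m a b Piece.S) (W := discField (planeCoord m a b) ρ)
        (fun q _ => discField_eq_deriv hI hν hρ hρ0 ht)
        (measurable_axialField measurable_const measurable_const) hU hUK
        (fun q hq => hvel t ht q (hUK hq)) (fun q hq => (hdiv t ht q hq).2) hf
      simp only [transportIntegrand, hΓ t ht]
      rw [hΩ t ht]
      refine ⟨h1, h2, h3.congr_of_eventuallyEq ?_⟩
      filter_upwards [hI.mem_nhds ht] with s hs
      rw [hΩ s hs]
      rfl
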